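/- **Setting.** Let $(V_k,X_k,Z_k)_{k\ge1}$ be i.i.d. random triples with values in $\mathbb R\times\mathcal X\times\mathcal Z$, distributed as $(V,X,Z)$, with $E|V|<\infty$. Let $\Theta\subset\mathbb R^q$ be open, $\beta_0\in\Theta$, and let $A(\beta,z)\in\mathbb R^q$ and $\mu(\beta,z)\in\mathbb R$ be measurable in $z$, with $E(V\mid Z)=\mu(\beta_0,Z)$ almost surely. Let $D$ be a real Banach space, $x\mapsto\delta_x$ a map from $\mathcal X$ to $D$, $\phi$ a real functional on $D$, and $F\in D$. Put $F_n=\frac1n\sum_{k=1}^n\delta_{X_k}$, $F_n^{(k)}=\frac1{n-1}\sum_{i\le n,\,i\ne k}\delta_{X_i}$, and define the pseudo-observations $\hat\theta_{n,k}=n\phi(F_n)-(n-1)\phi(F_n^{(k)})$. Assume: (a) $\|F-F_n\|_D=o_p(n^{-1/4})$, and $\|\delta_x\|_D\le c$ for all $x\in\mathcal X$ and some constant $0<c<\infty$; (b) $\phi$ is twice Fréchet differentiable in a neighbourhood of $F$, and its second derivative is Lipschitz continuous in a neighbourhood of $F$; (c) with $\dot\phi(x)=\phi_F'(\delta_x-F)$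 and $\ddot\phi(x,y)=\phi_F''(\delta_x-F,\delta_y-F)$ (both assumed measurable), $E(\dot\phi(X)\mid Z)=E(V\mid Z)-\phi(F)$ almost surely. For an estimator sequence $\hat\beta_n$ let $$\hat\Sigma_n^{HW}=\frac1n\sum_{k=1}^nA(\hat\beta_n,Z_k)A(\hat\beta_n,Z_k)^T\bigl(\hat\theta_{n,k}-\mu(\hat\beta_n,Z_k)\bigr)^2,$$ $$\tilde\Sigma=\mathrm{Cov}\Bigl(A(\beta_0,Z_1)\bigl(\phi(F)+\dot\phi(X_1)-\mu(\beta_0,Z_1)\bigr)\Bigr),$$ $$\Sigma=\mathrm{Cov}\Bigl(A(\beta_0,Z_1)\bigl(\phi(F)+\dot\phi(X_1)-\mu(\beta_0,Z_1)\bigr)+E\bigl(A(\beta_0,Z_2)\ddot\phi(X_2,X_1)\mid X_1\bigr)\Bigr).$$ **Theorem.** Assume in addition that 1. for every $z\in\mathcal Z$, the functions $\beta\mapsto A(\beta,z)$ and $\beta\mapsto\mu(\beta,z)$ are continuous on $\Theta$; 2. $A(\beta,Z)$ and $A(\beta,Z)\mu(\beta,Z)$ are dominated square integrable in a neighbourhood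 of $\beta_0$, that is, for each of them there are a neighbourhood $U$ of $\beta_0$ and a function $g$ with $E\,g(Z)^2<\infty$ such that almost surely its norm is at most $g(Z)$ for all $\beta\in U$; 3. $\hat\beta_n\to\beta_0$ in probability. Then the two random vectors $A(\beta_0,Z_1)(\phi(F)+\dot\phi(X_1)-\mu(\beta_0,Z_1))$ and $E(A(\beta_0,Z_2)\ddot\phi(X_2,X_1)\mid X_1)$ are square integrable, and $$\hat\Sigma_n^{HW}\xrightarrow{\;p\;}\tilde\Sigma .$$ The limit does not contain the second-order term, so $\hat\Sigma^{HW}_n$ is consistent for $\Sigma$ if and only if $\Sigma=\tilde\Sigma$. In general it is inconsistent: for every $q\ge1$ there is a model satisfying all the assumptions on the model and the conditions 1 and 2 (even with $\mathcal X=\mathcal Z=D=\mathbb R$) in which the estimating equation $\sum_{k=1}^nA(\beta,Z_k)(\hat\theta_{n,k}-\mu(\beta,Z_k))=0$ has measurable solutions $\hat\beta_n$ with $\hat\beta_n\to\beta_0$ in probability, and in which, for every $\hat\beta_n$ with $\hat\beta_n\to\beta_0$ in probability, $\hat\Sigma_n^{HW}$ does not converge to $\Sigma$ in probability. -/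

import Mathlib

open MeasureTheory ProbabilityTheory Filter Topology

/-- The data of a pseudo-observation regression problem with parameter dimension `q`:
a probability space with a sequence of triples `(V k, X k, Z k)`, the map `x ↦ delta x` into a
Banach space `D`, the functional `phi` on `D`, the point `F`, and the regression model
`(Theta, A, mu, beta0)`.  Only data; the assumptions are `PseudoModel.Assumptions`. -/
structure PseudoModel (Ω 𝒳 𝒵 D : Type*) [MeasurableSpace Ω] (q : ℕ) where
  P : Measure Ω
  V : ℕ → Ω → ℝ
  X : ℕ → Ω → 𝒳
  Z : ℕ → Ω → 𝒵
  delta : 𝒳 → D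
  phi : D → ℝ
  F : D
  Theta : Set (EuclideanSpace ℝ (Fin q))
  A : EuclideanSpace ℝ (Fin q) → 𝒵 → EuclideanSpace ℝ (Fin q)
  mu : EuclideanSpace ℝ (Fin q) → 𝒵 → ℝ
  beta0 : EuclideanSpace ℝ (Fin q)

namespace PseudoModel

noncomputable section

variable {Ω 𝒳 𝒵 D : Type*} [MeasurableSpace Ω] [MeasurableSpace 𝒳] [MeasurableSpace 𝒵]
  [NormedAddCommGroup D] [NormedSpace ℝ D] {q : ℕ}

/-- The sample average `F_n = n⁻¹ ∑_{k < n} δ_{X_k}`. -/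
def Fn (S : PseudoModel Ω 𝒳 𝒵 D q) (n : ℕ) (ω : Ω) : D :=
  (n : ℝ)⁻¹ • ∑ i ∈ Finset.range n, S.delta (S.X i ω)

/-- The leave-one-out average `F_n^{(k)} = (n - 1)⁻¹ ∑_{i < n, i ≠ k} δ_{X_i}`. -/
def FnLoo (S : PseudoModel Ω 𝒳 𝒵 D q) (n k : ℕ) (ω : Ω) : D :=
  ((n : ℝ) - 1)⁻¹ • ∑ i ∈ (Finset.range n).erase k, S.delta (S.X i ω)

/-- The jackknife pseudo-observation `n φ(F_n) - (n - 1) φ(F_n^{(k)})`. -/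
def pseudoObs (S : PseudoModel Ω 𝒳 𝒵 D q) (n k : ℕ) (ω : Ω) : ℝ :=
  (n : ℝ) * S.phi (S.Fn n ω) - ((n : ℝ) - 1) * S.phi (S.FnLoo n k ω)

/-- First-order influence function `φ'_F(δ_x - F)`. -/
def phiDot (S : PseudoModel Ω 𝒳 𝒵 D q) (x : 𝒳) : ℝ :=
  fderiv ℝ S.phi S.F (S.delta x - S.F)

/-- Second-order influence function `φ''_F(δ_x - F, δ_y - F)`. -/
def phiDDot (S : PseudoModel Ω 𝒳 𝒵 D q) (x y : 𝒳) : ℝ :=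
  fderiv ℝ (fderiv ℝ S.phi) S.F (S.delta x - S.F) (S.delta y - S.F)

/-- The standing assumptions on the model. -/
structure Assumptions (S : PseudoModel Ω 𝒳 𝒵 D q) : Prop where
  prob : IsProbabilityMeasure S.P
  measurable_V : ∀ k, Measurable (S.V k)
  measurable_X : ∀ k, Measurable (S.X k)
  measurable_Z : ∀ k, Measurable (S.Z k)
  indep : iIndepFun (fun k ω => (S.V k ω, S.X k ω, S.Z k ω)) S.P
  identDistrib : ∀ k, IdentDistrib (fun ω => (S.V k ω, S.X k ω, S.Z k ω))
    (fun ω => (S.V 0 ω, S.X 0 ω, S.Z 0 ω)) S.P S.P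
  integrable_V : Integrable (S.V 0) S.P
  isOpen_Theta : IsOpen S.Theta
  beta0_mem : S.beta0 ∈ S.Theta
  measurable_A : ∀ β ∈ S.Theta, Measurable (S.A β)
  measurable_mu : ∀ β ∈ S.Theta, Measurable (S.mu β)
  measurable_phiDot : Measurable S.phiDot
  measurable_phiDDot : Measurable fun p : 𝒳 × 𝒳 => S.phiDDot p.1 p.2
  /-- Correctly specified mean function: `E(V | Z) = μ(β₀, Z)`. -/
  mean : S.P[S.V 0 | MeasurableSpace.comap (S.Z 0) inferInstance]
    =ᵐ[S.P] fun ω => S.mu S.beta0 (S.Z 0 ω)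
  /-- `‖F - F_n‖ = o_p(n^{-1/4})`. -/
  rate : TendstoInMeasure S.P
    (fun (n : ℕ) ω => (n : ℝ) ^ (1 / 4 : ℝ) * ‖S.F - S.Fn n ω‖) atTop (fun _ => 0)
  bounded_delta : ∃ c : ℝ, 0 < c ∧ ∀ x, ‖S.delta x‖ ≤ c
  /-- `φ` is twice Fréchet differentiable in a neighbourhood of `F`, with Lipschitz second
  derivative there. -/
  smooth : ∃ U ∈ 𝓝 S.F, (∀ x ∈ U, DifferentiableAt ℝ S.phi x) ∧
    (∀ x ∈ U, DifferentiableAt ℝ (fderiv ℝ S.phi) x) ∧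
    ∃ K, LipschitzOnWith K (fderiv ℝ (fderiv ℝ S.phi)) U
  /-- `E(φ̇(X) | Z) = E(V | Z) - φ(F)`. -/
  centering : S.P[fun ω => S.phiDot (S.X 0 ω) | MeasurableSpace.comap (S.Z 0) inferInstance]
    =ᵐ[S.P] fun ω =>
      (S.P[S.V 0 | MeasurableSpace.comap (S.Z 0) inferInstance]) ω - S.phi S.F

/-- `f(β, Z)` is dominated square integrable in a neighbourhood of `β₀`. -/
def DominatedSqIntegrable (S : PseudoModel Ω 𝒳 𝒵 D q)
    (f : EuclideanSpace ℝ (Fin q) → 𝒵 → EuclideanSpace ℝ (Fin q)) : Prop :=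
  ∃ U ∈ 𝓝 S.beta0, ∃ g : 𝒵 → ℝ, MemLp g 2 (S.P.map (S.Z 0)) ∧
    ∀ᵐ z ∂(S.P.map (S.Z 0)), ∀ β ∈ U, ‖f β z‖ ≤ g z

/-- Continuity in `β` and local dominated square integrability. -/
structure Regularity (S : PseudoModel Ω 𝒳 𝒵 D q) : Prop where
  continuous_A : ∀ z, ContinuousOn (fun β => S.A β z) S.Theta
  continuous_mu : ∀ z, ContinuousOn (fun β => S.mu β z) S.Theta
  dominated_A : S.DominatedSqIntegrable S.A
  dominated_A_mu : S.DominatedSqIntegrable fun β z => S.mu β z • S.A β z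

/-- `β̂_n → β₀` in probability. -/
def Consistent (S : PseudoModel Ω 𝒳 𝒵 D q) (βhat : ℕ → Ω → EuclideanSpace ℝ (Fin q)) : Prop :=
  TendstoInMeasure S.P βhat atTop (fun _ => S.beta0)

/-- `β̂_n` solves `∑_{k < n} A(β, Z_k) (θ̂_{n,k} - μ(β, Z_k)) = 0`, for every `n`. -/
def SolvesEstimatingEq (S : PseudoModel Ω 𝒳 𝒵 D q)
    (βhat : ℕ → Ω → EuclideanSpace ℝ (Fin q)) : Prop :=
  ∀ n ω, ∑ k ∈ Finset.range n,
    (S.pseudoObs n k ω - S.mu (βhat n ω) (S.Z k ω)) • S.A (βhat n ω) (S.Z k ω) = 0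

/-- The Huber–White estimator
`n⁻¹ ∑_{k < n} A(β̂_n, Z_k) A(β̂_n, Z_k)ᵀ (θ̂_{n,k} - μ(β̂_n, Z_k))²`. -/
def huberWhite (S : PseudoModel Ω 𝒳 𝒵 D q) (βhat : ℕ → Ω → EuclideanSpace ℝ (Fin q))
    (n : ℕ) (ω : Ω) : Matrix (Fin q) (Fin q) ℝ :=
  (n : ℝ)⁻¹ • ∑ k ∈ Finset.range n,
    (S.pseudoObs n k ω - S.mu (βhat n ω) (S.Z k ω)) ^ 2 •
      Matrix.vecMulVec (S.A (βhat n ω) (S.Z k ω)).ofLp (S.A (βhat n ω) (S.Z k ω)).ofLp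

/-- `A(β₀, Z₁) (φ(F) + φ̇(X₁) - μ(β₀, Z₁))`; the first observation has index `0`. -/
def firstOrderTerm (S : PseudoModel Ω 𝒳 𝒵 D q) (ω : Ω) : EuclideanSpace ℝ (Fin q) :=
  (S.phi S.F + S.phiDot (S.X 0 ω) - S.mu S.beta0 (S.Z 0 ω)) • S.A S.beta0 (S.Z 0 ω)

/-- `E(A(β₀, Z₂) φ̈(X₂, X₁) | X₁)`; the first two observations have indices `0` and `1`. -/
def secondOrderTerm (S : PseudoModel Ω 𝒳 𝒵 D q) : Ω → EuclideanSpace ℝ (Fin q) :=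
  S.P[fun ω => S.phiDDot (S.X 1 ω) (S.X 0 ω) • S.A S.beta0 (S.Z 1 ω) |
    MeasurableSpace.comap (S.X 0) inferInstance]

/-- The covariance matrix of a random vector. -/
def covMatrix (P : Measure Ω) (Y : Ω → EuclideanSpace ℝ (Fin q)) : Matrix (Fin q) (Fin q) ℝ :=
  Matrix.of fun i j => covariance (fun ω => Y ω i) (fun ω => Y ω j) P

/-- `Σ̃ = Cov(A(β₀, Z₁) (φ(F) + φ̇(X₁) - μ(β₀, Z₁)))`. -/
def SigmaTilde (S : PseudoModel Ω 𝒳 𝒵 D q) : Matrix (Fin q) (Fin q) ℝ :=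
  covMatrix S.P S.firstOrderTerm

/-- `Σ = Cov(A(β₀, Z₁) (φ(F) + φ̇(X₁) - μ(β₀, Z₁)) + E(A(β₀, Z₂) φ̈(X₂, X₁) | X₁))`. -/
def Sigma (S : PseudoModel Ω 𝒳 𝒵 D q) : Matrix (Fin q) (Fin q) ℝ :=
  covMatrix S.P fun ω => S.firstOrderTerm ω + S.secondOrderTerm ω

/-- Convergence in probability of random matrices to a constant matrix. -/
def MatrixTendstoInProb (P : Measure Ω) (M : ℕ → Ω → Matrix (Fin q) (Fin q) ℝ)
    (L : Matrix (Fin q) (Fin q) ℝ) : Prop :=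
  ∀ i j, TendstoInMeasure P (fun n ω => M n ω i j) atTop (fun _ => L i j)

end

end PseudoModel

/-! The pseudo-observation is φ(F_n) + (n-1)(φ(F_n) - φ(F_n^{(k)})), and deleting one point moves
F_n by (δ_{X_k} - F_n)/(n-1). Since φ is strictly differentiable at F, the second summand is
φ'_F(δ_{X_k} - F_n) plus a remainder that is small uniformly in k, because the factor n-1 cancels
the size of the step. Hence `Assumptions.pseudoObs_approx`: every θ̂_{n,k} is within ε of φ(F) +
φ̇(X_k) once n is large and F_n is near F. The second-order influence lies inside this uniform
error, and an average of squares does not see it.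

To exploit this, the error of θ̂_{n,k} is treated as one more parameter next to β̂_n. Each entry of
the estimator is then an average of a dominated family, continuous in (β, error), evaluated
uniformly near (β₀, 0). By `tendstoInMeasure_average_sub` the parameter may be replaced by (β₀, 0),
and the strong law gives a second moment. This is the covariance Σ̃, since the first-order term is
centred (`Assumptions.integral_firstOrderTerm_apply`). Uniqueness of limits in probability gives the
equivalence with Σ = Σ̃.

For inconsistency, `SignModel.model` takes q groups, a covariate sign s and a noise sign e, V = X =
s + e, and φ(x) = x² + x at F = 0. The first-order term in coordinate j is se on group j; the
second-order term is 2X/q. They are uncorrelated, so Σ_jj exceeds Σ̃_jj by 8/q². -/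

/-! ### Averages with estimated parameters -/

section UniformAverages

variable {Ω S T : Type*} [MeasurableSpace Ω] [MeasurableSpace S]
  [PseudoMetricSpace T] [SecondCountableTopology T]

open scoped ENNReal

/-- Local moduli of continuity of a dominated family of integrable functions, uniformly over small
balls of parameters, have arbitrarily small integral. -/
theorem exists_measurable_modulus {ν : Measure S} {f : T → S → ℝ} {t₀ : T} {Θ : Set T}
    (hΘ : Θ ∈ 𝓝 t₀) (hfm : ∀ t ∈ Θ, Measurable (f t))
    (hfc : ∀ s, ContinuousOn (fun t => f t s) Θ) {U : Set T} (hU : U ∈ 𝓝 t₀) {g : S → ℝ}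
    (hg : Integrable g ν) (hfg : ∀ᵐ s ∂ν, ∀ t ∈ U, |f t s| ≤ g s) {η : ℝ≥0∞} (hη : 0 < η) :
    ∃ r > 0, ∃ w : S → ℝ≥0∞, Measurable w ∧ ∫⁻ s, w s ∂ν ≤ η ∧
      ∀ s, ∀ t ∈ Metric.ball t₀ r, ‖f t s - f t₀ s‖ₑ ≤ w s := by
  obtain ⟨r₀, hr₀, hball⟩ := Metric.mem_nhds_iff.1 (inter_mem hΘ hU)
  obtain ⟨D, hDc, hDd⟩ := TopologicalSpace.exists_countable_dense T
  have ht₀ : t₀ ∈ Θ := mem_of_mem_nhds hΘ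
  have ht₀U : t₀ ∈ U := mem_of_mem_nhds hU
  let ρ : ℕ → ℝ := fun m => r₀ / (m + 1)
  have hρ : ∀ m, 0 < ρ m := fun m => by positivity
  have hρle : ∀ m, ρ m ≤ r₀ := fun m => div_le_self hr₀.le (by simp)
  have hsub : ∀ m, Metric.ball t₀ (ρ m) ⊆ Θ ∩ U := fun m =>
    (Metric.ball_subset_ball (hρle m)).trans hball
  -- The supremum runs over a countable dense set to keep `w m` measurable; continuity in t extends
  -- the bound to the whole ball.
  let w : ℕ → S → ℝ≥0∞ := fun m s => ⨆ t ∈ D ∩ Metric.ball t₀ (ρ m), ‖f t s - f t₀ s‖ₑ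
  have hwm : ∀ m, Measurable (w m) := fun m =>
    Measurable.biSup _ (hDc.mono Set.inter_subset_left) fun t ht =>
      ((hfm t (hsub m ht.2).1).sub (hfm t₀ ht₀)).enorm
  have hbound : ∀ m s, ∀ t ∈ Metric.ball t₀ (ρ m), ‖f t s - f t₀ s‖ₑ ≤ w m s := by
    intro m s t ht
    have hcl : t ∈ closure (Metric.ball t₀ (ρ m) ∩ D) :=
      hDd.open_subset_closure_inter Metric.isOpen_ball ht
    rw [Set.inter_comm, mem_closure_iff_nhdsWithin_neBot] at hcl
    have hc : ContinuousWithinAt (fun t => ‖f t s - f t₀ s‖ₑ) (D ∩ Metric.ball t₀ (ρ m)) t := by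
      have h1 : ContinuousWithinAt (fun t => f t s) (D ∩ Metric.ball t₀ (ρ m)) t :=
        (hfc s t (hsub m ht).1).mono fun x hx => (hsub m hx.2).1
      exact (h1.sub continuousWithinAt_const).enorm
    refine le_of_tendsto hc ?_
    filter_upwards [self_mem_nhdsWithin] with x hx
    exact le_iSup₂ (f := fun t (_ : t ∈ D ∩ Metric.ball t₀ (ρ m)) => ‖f t s - f t₀ s‖ₑ) x hx
  have hlim : Tendsto (fun m => ∫⁻ s, w m s ∂ν) atTop (𝓝 (∫⁻ _, 0 ∂ν)) := by
    refine tendsto_lintegral_of_dominated_convergence (fun s => ‖g s + g s‖ₑ) hwm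
      (fun m => ?_) (hg.add hg).2.ne ?_
    · filter_upwards [hfg] with s hs
      refine iSup₂_le fun t ht => ?_
      rw [enorm_le_iff_norm_le, Real.norm_eq_abs, Real.norm_eq_abs]
      calc |f t s - f t₀ s| ≤ |f t s| + |f t₀ s| := abs_sub _ _
        _ ≤ g s + g s := add_le_add (hs t (hsub m ht.2).2) (hs t₀ ht₀U)
        _ ≤ _ := le_abs_self _
    · refine Eventually.of_forall fun s => ?_
      rw [ENNReal.tendsto_nhds_zero]
      intro ε hε
      have hc : ContinuousAt (fun t => ‖f t s - f t₀ s‖ₑ) t₀ :=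
        (((hfc s).continuousAt hΘ).sub continuousAt_const).enorm
      have h0 : Tendsto (fun t => ‖f t s - f t₀ s‖ₑ) (𝓝 t₀) (𝓝 0) := by
        simpa [ContinuousAt] using hc
      obtain ⟨δ, hδ, hδ'⟩ := Metric.eventually_nhds_iff.1 ((ENNReal.tendsto_nhds_zero.1 h0) ε hε)
      have hρlim : Tendsto ρ atTop (𝓝 0) := by
        simpa [ρ, div_eq_mul_one_div r₀] using
          (tendsto_one_div_add_atTop_nhds_zero_nat (𝕜 := ℝ)).const_mul r₀
      filter_upwards [hρlim.eventually (gt_mem_nhds hδ)] with m hm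
      exact iSup₂_le fun t ht => hδ' ((Metric.mem_ball.1 ht.2).trans hm)
  rw [lintegral_zero] at hlim
  obtain ⟨m, hm⟩ := ((ENNReal.tendsto_nhds_zero.1 hlim) η hη).exists
  exact ⟨ρ m, hρ m, w m, hwm m, hm, hbound m⟩

/-- Averages over a stationary sequence of a dominated, continuously parametrized family are
asymptotically unaffected by replacing the parameter by uniformly consistent parameters. -/
theorem tendstoInMeasure_average_sub {μ : Measure Ω} [IsProbabilityMeasure μ] {ξ : ℕ → Ω → S}
    {ν : Measure S} (hξ : ∀ k, Measurable (ξ k)) (hlaw : ∀ k, μ.map (ξ k) = ν)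
    {f : T → S → ℝ} {t₀ : T} {Θ : Set T}
    (hΘ : Θ ∈ 𝓝 t₀) (hfm : ∀ t ∈ Θ, Measurable (f t))
    (hfc : ∀ s, ContinuousOn (fun t => f t s) Θ) {U : Set T} (hU : U ∈ 𝓝 t₀) {g : S → ℝ}
    (hg : Integrable g ν) (hfg : ∀ᵐ s ∂ν, ∀ t ∈ U, |f t s| ≤ g s) {τ : ℕ → ℕ → Ω → T}
    (hτ : ∀ r > 0, Tendsto (fun n => μ {ω | ∃ k < n, r ≤ dist (τ n k ω) t₀}) atTop (𝓝 0)) :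
    TendstoInMeasure μ (fun (n : ℕ) ω => (n : ℝ)⁻¹ * ∑ k ∈ Finset.range n, f (τ n k ω) (ξ k ω) -
      (n : ℝ)⁻¹ * ∑ k ∈ Finset.range n, f t₀ (ξ k ω)) atTop (fun _ => 0) := by
  refine tendstoInMeasure_of_ne_top fun ε hε hεtop => ?_
  rw [ENNReal.tendsto_nhds_zero]
  intro η hη
  have hη2 : 0 < η / 2 := ENNReal.half_pos hη.ne'
  -- Markov's inequality at level ε turns the bound ε · (η / 2) into η / 2.
  obtain ⟨r, hr, w, hwm, hwi, hw⟩ := exists_measurable_modulus hΘ hfm hfc hU hg hfg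
    (η := ε * (η / 2)) (by positivity)
  filter_upwards [(ENNReal.tendsto_nhds_zero.1 (hτ r hr)) (η / 2) hη2,
    eventually_gt_atTop 0] with n hn hn0
  let W : Ω → ℝ≥0∞ := fun ω => (n : ℝ≥0∞)⁻¹ * ∑ k ∈ Finset.range n, w (ξ k ω)
  have hwξ : ∀ k, Measurable fun ω => w (ξ k ω) := fun k => hwm.comp (hξ k)
  have hWm : Measurable W := (Finset.measurable_fun_sum _ fun k _ => hwξ k).const_mul _
  have hWi : ∫⁻ ω, W ω ∂μ ≤ ε * (η / 2) := by
    have h1 : ∀ k, ∫⁻ ω, w (ξ k ω) ∂μ = ∫⁻ s, w s ∂ν := fun k => by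
      rw [← hlaw k, lintegral_map hwm (hξ k)]
    simp only [W]
    rw [lintegral_const_mul _ (Finset.measurable_fun_sum _ fun k _ => hwξ k),
      lintegral_finsetSum _ fun k _ => hwξ k]
    simp only [h1, Finset.sum_const, Finset.card_range, nsmul_eq_mul]
    rw [← mul_assoc, ENNReal.inv_mul_cancel (by simpa using hn0.ne') (by simp), one_mul]
    exact hwi
  have hWε : μ {ω | ε ≤ W ω} ≤ η / 2 := by
    refine (meas_ge_le_lintegral_div hWm.aemeasurable hε.ne' hεtop).trans ?_
    exact ENNReal.div_le_of_le_mul' hWi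
  -- Nothing is assumed measurable about τ: only the majorant W enters Markov's inequality, and the
  -- rest is outer-measure monotonicity.
  have hsub : {ω | ε ≤ edist ((n : ℝ)⁻¹ * ∑ k ∈ Finset.range n, f (τ n k ω) (ξ k ω) -
      (n : ℝ)⁻¹ * ∑ k ∈ Finset.range n, f t₀ (ξ k ω)) 0} ⊆
      {ω | ∃ k < n, r ≤ dist (τ n k ω) t₀} ∪ {ω | ε ≤ W ω} := by
    intro ω hω
    by_cases hk : ∃ k < n, r ≤ dist (τ n k ω) t₀
    · exact Or.inl hk
    · right
      push Not at hk
      refine le_trans (Set.mem_ofPred_eq ▸ hω) ?_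
      rw [edist_zero_right, ← mul_sub, ← Finset.sum_sub_distrib, enorm_mul]
      have hnn : ‖(n : ℝ)⁻¹‖ₑ = (n : ℝ≥0∞)⁻¹ := by
        rw [enorm_inv (by positivity)]
        simp
      rw [hnn]
      refine mul_le_mul_right ?_ _
      refine (enorm_sum_le _ _).trans (Finset.sum_le_sum fun k hk' => ?_)
      exact hw _ _ (hk k (Finset.mem_range.1 hk'))
  calc _ ≤ μ {ω | ∃ k < n, r ≤ dist (τ n k ω) t₀} + μ {ω | ε ≤ W ω} :=
        (measure_mono hsub).trans (measure_union_le _ _)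
    _ ≤ η / 2 + η / 2 := add_le_add hn hWε
    _ = η := ENNReal.add_halves η

end UniformAverages

/-- Sums of limits in measure, without any measurability. -/
theorem TendstoInMeasure.add_real {Ω : Type*} [MeasurableSpace Ω] {μ : Measure Ω}
    {f g : ℕ → Ω → ℝ} {a b : ℝ} (hf : TendstoInMeasure μ f atTop (fun _ => a))
    (hg : TendstoInMeasure μ g atTop (fun _ => b)) :
    TendstoInMeasure μ (fun n ω => f n ω + g n ω) atTop (fun _ => a + b) := by
  rw [tendstoInMeasure_iff_norm] at *
  intro ε hε
  have h := (hf (ε / 2) (by positivity)).add (hg (ε / 2) (by positivity))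
  rw [add_zero] at h
  refine tendsto_of_tendsto_of_tendsto_of_le_of_le tendsto_const_nhds h (fun _ => zero_le) ?_
  intro n
  refine (measure_mono ?_).trans (measure_union_le _ _)
  intro ω hω
  by_contra hcon
  simp only [Set.mem_union, Set.mem_ofPred_eq, not_or, not_le] at hcon hω
  have : ‖f n ω + g n ω - (a + b)‖ ≤ ‖f n ω - a‖ + ‖g n ω - b‖ := by
    rw [add_sub_add_comm]; exact norm_add_le _ _
  linarith [hcon.1, hcon.2]

/-! ### Linearization of the pseudo-observations -/

namespace PseudoModel

section Consistency

variable {Ω 𝒳 𝒵 D : Type*} [MeasurableSpace Ω]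
  [NormedAddCommGroup D] [NormedSpace ℝ D] {q : ℕ} {S : PseudoModel Ω 𝒳 𝒵 D q}

/-- Follows from (n-1) F_n^{(k)} = n F_n - δ_{X_k}. Centring at F separates the influence of X_k
from a term that vanishes as F_n → F. -/
theorem sub_smul_Fn_sub_FnLoo (S : PseudoModel Ω 𝒳 𝒵 D q) {n k : ℕ} (hn : 2 ≤ n) (hk : k < n)
    (ω : Ω) :
    ((n : ℝ) - 1) • (S.Fn n ω - S.FnLoo n k ω) =
      (S.delta (S.X k ω) - S.F) - (S.Fn n ω - S.F) := by
  have hn2 : (2 : ℝ) ≤ n := by exact_mod_cast hn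
  have h1 : (n : ℝ) • S.Fn n ω = ∑ i ∈ Finset.range n, S.delta (S.X i ω) := by
    rw [Fn, smul_inv_smul₀ (by linarith)]
  have h2 : ((n : ℝ) - 1) • S.FnLoo n k ω =
      ∑ i ∈ (Finset.range n).erase k, S.delta (S.X i ω) := by
    rw [FnLoo, smul_inv_smul₀ (by linarith)]
  have h3 := Finset.add_sum_erase (Finset.range n) (fun i => S.delta (S.X i ω))
    (Finset.mem_range.2 hk)
  rw [smul_sub, h2, sub_smul, one_smul, h1, ← h3]
  abel

/-- The summand of an entry of the Huber-White estimator, as a function of the regression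
parameter, an error of the pseudo-observation, and the covariates. -/
noncomputable def scoreProduct (S : PseudoModel Ω 𝒳 𝒵 D q) (i j : Fin q)
    (t : EuclideanSpace ℝ (Fin q) × ℝ) (s : 𝒳 × 𝒵) : ℝ :=
  ((S.phi S.F + S.phiDot s.1 + t.2 - S.mu t.1 s.2) * S.A t.1 s.2 i) *
    ((S.phi S.F + S.phiDot s.1 + t.2 - S.mu t.1 s.2) * S.A t.1 s.2 j)

/-- Moving the error of the pseudo-observation into the parameter slot leaves a summand depending on
observation k alone, at a parameter varying with k. -/
theorem huberWhite_apply (S : PseudoModel Ω 𝒳 𝒵 D q)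
    (βhat : ℕ → Ω → EuclideanSpace ℝ (Fin q)) (n : ℕ) (ω : Ω) (i j : Fin q) :
    S.huberWhite βhat n ω i j = (n : ℝ)⁻¹ * ∑ k ∈ Finset.range n, S.scoreProduct i j
      (βhat n ω, S.pseudoObs n k ω - (S.phi S.F + S.phiDot (S.X k ω))) (S.X k ω, S.Z k ω) := by
  simp only [huberWhite, scoreProduct, Matrix.smul_apply, Matrix.sum_apply, smul_eq_mul,
    Matrix.vecMulVec_apply]
  congr 1
  exact Finset.sum_congr rfl fun k _ => by ring

variable [MeasurableSpace 𝒵]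

theorem Regularity.continuousOn_scoreProduct (hR : S.Regularity) (i j : Fin q) (s : 𝒳 × 𝒵) :
    ContinuousOn (fun t => S.scoreProduct i j t s) (S.Theta ×ˢ Set.univ) := by
  have hfst : ContinuousOn (Prod.fst : EuclideanSpace ℝ (Fin q) × ℝ → _)
      (S.Theta ×ˢ Set.univ) := continuousOn_fst
  have hmaps : Set.MapsTo (Prod.fst : EuclideanSpace ℝ (Fin q) × ℝ → _)
      (S.Theta ×ˢ Set.univ) S.Theta := fun t ht => ht.1
  have h2 := (hR.continuous_mu s.2).comp hfst hmaps
  have h3 : ∀ i, ContinuousOn (fun t : EuclideanSpace ℝ (Fin q) × ℝ => S.A t.1 s.2 i)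
      (S.Theta ×ˢ Set.univ) := fun i =>
    (EuclideanSpace.proj i : EuclideanSpace ℝ (Fin q) →L[ℝ] ℝ).continuous.comp_continuousOn
      ((hR.continuous_A s.2).comp hfst hmaps)
  have h4 := (continuousOn_const (c := S.phi S.F + S.phiDot s.1)).add
    (continuousOn_snd (s := S.Theta ×ˢ (Set.univ : Set ℝ))) |>.sub h2
  exact (h4.mul (h3 i)).mul (h4.mul (h3 j))

variable [MeasurableSpace 𝒳]

/-- The derivative of φ is itself differentiable at F, hence continuous there. Strictness is needed
because the two points compared, F_n and F_n^{(k)}, both move. -/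
theorem Assumptions.hasStrictFDerivAt (hS : S.Assumptions) :
    HasStrictFDerivAt S.phi (fderiv ℝ S.phi S.F) S.F := by
  obtain ⟨U, hU, h1, h2, -⟩ := hS.smooth
  refine hasStrictFDerivAt_of_hasFDerivAt_of_continuousAt ?_ (h2 _ (mem_of_mem_nhds hU)).continuousAt
  filter_upwards [hU] with x hx using (h1 x hx).hasFDerivAt

/-- The pseudo-observations are uniformly close to `φ(F) + φ̇(X_k)` once `F_n` is close to `F`. -/
theorem Assumptions.pseudoObs_approx (hS : S.Assumptions) {ε : ℝ} (hε : 0 < ε) :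
    ∃ r > 0, ∃ N : ℕ, ∀ n ≥ N, ∀ ω, ‖S.F - S.Fn n ω‖ < r → ∀ k < n,
      |S.pseudoObs n k ω - (S.phi S.F + S.phiDot (S.X k ω))| ≤ ε := by
  obtain ⟨c, hc, hδ⟩ := hS.bounded_delta
  set L := fderiv ℝ S.phi S.F with hL
  have hstrict := hS.hasStrictFDerivAt
  have hM : 0 < c + ‖S.F‖ + 1 := by positivity
  set M := c + ‖S.F‖ + 1 with hMdef
  obtain ⟨r₁, hr₁, h₁⟩ := Metric.continuousAt_iff.1 hstrict.continuousAt (ε / 3) (by positivity)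
  have hlo := (hasStrictFDerivAt_iff_isLittleO.1 hstrict).def (c := ε / (3 * M)) (by positivity)
  obtain ⟨r₂, hr₂, h₂⟩ := Metric.eventually_nhds_iff.1 hlo
  -- M bounds ‖δ_{X_k} - F_n‖ when ‖F_n - F‖ < 1, so this N forces ‖F_n - F_n^{(k)}‖ < r₂ / 2. With
  -- ‖F_n - F‖ < r₂ / 2, both points then lie within r₂ of F.
  obtain ⟨N, hN⟩ := exists_nat_gt (2 * M / r₂ + 1)
  refine ⟨min (min r₁ (r₂ / 2)) (min 1 (ε / (3 * (‖L‖ + 1)))), by positivity, max N 2, ?_⟩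
  intro n hn ω hω k hk
  have hn2 : 2 ≤ n := le_trans (le_max_right _ _) hn
  have hnN : (N : ℝ) ≤ n := by exact_mod_cast le_trans (le_max_left _ _) hn
  have hn2' : (2 : ℝ) ≤ n := by exact_mod_cast hn2
  simp only [lt_min_iff] at hω
  obtain ⟨⟨hω1, hω2⟩, hω3, hω4⟩ := hω
  rw [norm_sub_rev] at hω1 hω2 hω3 hω4
  set x := S.Fn n ω with hx
  set y := S.FnLoo n k ω with hy
  set d := S.delta (S.X k ω) - S.F with hd
  have halg : ((n : ℝ) - 1) • (x - y) = d - (x - S.F) := S.sub_smul_Fn_sub_FnLoo hn2 hk ω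
  have hdn : ‖d - (x - S.F)‖ ≤ M := by
    calc ‖d - (x - S.F)‖ ≤ ‖d‖ + ‖x - S.F‖ := norm_sub_le _ _
      _ ≤ (‖S.delta (S.X k ω)‖ + ‖S.F‖) + 1 := add_le_add (norm_sub_le _ _) hω3.le
      _ ≤ M := by rw [hMdef]; gcongr; exact hδ _
  have hxy : ((n : ℝ) - 1) * ‖x - y‖ ≤ M := by
    rw [← halg, norm_smul, Real.norm_of_nonneg (by linarith)] at hdn
    exact hdn
  have hxy2 : ‖x - y‖ < r₂ / 2 := by
    have h3 : 2 * M / r₂ < (n : ℝ) - 1 := by linarith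
    rw [div_lt_iff₀ hr₂] at h3
    by_contra hcon
    push Not at hcon
    nlinarith [mul_le_mul_of_nonneg_left hcon (by linarith : (0 : ℝ) ≤ (n : ℝ) - 1)]
  have hyF : ‖y - S.F‖ < r₂ := by
    have : y - S.F = (x - S.F) - (x - y) := by abel
    rw [this]
    linarith [norm_sub_le (x - S.F) (x - y)]
  have e1 : |S.phi x - S.phi S.F| ≤ ε / 3 := by
    have := h₁ (x := x) (by rw [dist_eq_norm]; exact hω1)
    rw [Real.dist_eq] at this
    exact this.le
  -- The strict-derivative remainder is at most ε/(3M) times ‖x - y‖, and (n-1)‖x - y‖ ≤ M absorbs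
  -- the factor n-1.
  have e2 : |((n : ℝ) - 1) * (S.phi x - S.phi y - L (x - y))| ≤ ε / 3 := by
    have h4 : ‖S.phi x - S.phi y - L (x - y)‖ ≤ ε / (3 * M) * ‖x - y‖ := by
      refine h₂ (y := (x, y)) ?_
      rw [Prod.dist_eq, dist_eq_norm, dist_eq_norm]
      exact max_lt (by linarith) hyF
    rw [Real.norm_eq_abs] at h4
    rw [abs_mul, abs_of_nonneg (by linarith : (0 : ℝ) ≤ (n : ℝ) - 1)]
    calc ((n : ℝ) - 1) * |S.phi x - S.phi y - L (x - y)|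
        ≤ ((n : ℝ) - 1) * (ε / (3 * M) * ‖x - y‖) :=
          mul_le_mul_of_nonneg_left h4 (by linarith)
      _ = ε / (3 * M) * (((n : ℝ) - 1) * ‖x - y‖) := by ring
      _ ≤ ε / (3 * M) * M := by gcongr
      _ = ε / 3 := by field_simp
  have e3 : |L (x - S.F)| ≤ ε / 3 := by
    calc |L (x - S.F)| ≤ ‖L‖ * ‖x - S.F‖ := L.le_opNorm _
      _ ≤ (‖L‖ + 1) * (ε / (3 * (‖L‖ + 1))) := by gcongr; linarith
      _ = ε / 3 := by field_simp
  have e4 : ((n : ℝ) - 1) * L (x - y) = L d - L (x - S.F) := by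
    rw [← map_sub, ← halg, map_smul, smul_eq_mul]
  have e5 : S.pseudoObs n k ω - (S.phi S.F + S.phiDot (S.X k ω)) =
      (S.phi x - S.phi S.F) + ((n : ℝ) - 1) * (S.phi x - S.phi y - L (x - y)) - L (x - S.F) := by
    rw [pseudoObs, phiDot]
    linear_combination e4
  rw [e5]
  calc _ ≤ |S.phi x - S.phi S.F| + |((n : ℝ) - 1) * (S.phi x - S.phi y - L (x - y))|
        + |L (x - S.F)| := (abs_sub _ _).trans (add_le_add_left (abs_add_le _ _) _)
    _ ≤ ε := by linarith

/-! ### Measurability, envelopes and moments -/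

theorem Assumptions.exists_abs_phiDot_le (hS : S.Assumptions) :
    ∃ M, 0 ≤ M ∧ ∀ x, |S.phiDot x| ≤ M := by
  obtain ⟨c, hc, hδ⟩ := hS.bounded_delta
  refine ⟨‖fderiv ℝ S.phi S.F‖ * (c + ‖S.F‖), by positivity, fun x => ?_⟩
  refine ((fderiv ℝ S.phi S.F).le_opNorm _).trans ?_
  gcongr
  exact (norm_sub_le _ _).trans (add_le_add_left (hδ x) _)

theorem Assumptions.exists_abs_phiDDot_le (hS : S.Assumptions) :
    ∃ M, 0 ≤ M ∧ ∀ x y, |S.phiDDot x y| ≤ M := by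
  obtain ⟨c, hc, hδ⟩ := hS.bounded_delta
  refine ⟨‖fderiv ℝ (fderiv ℝ S.phi) S.F‖ * (c + ‖S.F‖) * (c + ‖S.F‖), by positivity,
    fun x y => ?_⟩
  refine ((fderiv ℝ (fderiv ℝ S.phi) S.F).le_opNorm₂ _ _).trans ?_
  have h : ∀ x, ‖S.delta x - S.F‖ ≤ c + ‖S.F‖ := fun x =>
    (norm_sub_le _ _).trans (add_le_add_left (hδ x) _)
  gcongr <;> exact h _

theorem Assumptions.measurable_coord_A (hS : S.Assumptions) {β : EuclideanSpace ℝ (Fin q)}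
    (hβ : β ∈ S.Theta) (i : Fin q) : Measurable fun z => S.A β z i :=
  ((EuclideanSpace.proj i : EuclideanSpace ℝ (Fin q) →L[ℝ] ℝ).continuous.measurable).comp
    (hS.measurable_A β hβ)

theorem Assumptions.measurable_scoreProduct (hS : S.Assumptions) (i j : Fin q)
    {t : EuclideanSpace ℝ (Fin q) × ℝ} (ht : t.1 ∈ S.Theta) : Measurable (S.scoreProduct i j t) := by
  have h1 := hS.measurable_phiDot.comp (measurable_fst : Measurable (Prod.fst : 𝒳 × 𝒵 → 𝒳))
  have h2 := (hS.measurable_mu _ ht).comp (measurable_snd : Measurable (Prod.snd : 𝒳 × 𝒵 → 𝒵))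
  have h3 : ∀ i, Measurable fun s : 𝒳 × 𝒵 => S.A t.1 s.2 i := fun i =>
    (hS.measurable_coord_A ht i).comp measurable_snd
  have h4 := ((h1.const_add (S.phi S.F)).add_const t.2).sub h2
  exact (h4.mul (h3 i)).mul (h4.mul (h3 j))

theorem Assumptions.measurable_XZ (hS : S.Assumptions) (k : ℕ) :
    Measurable fun ω => (S.X k ω, S.Z k ω) :=
  (hS.measurable_X k).prodMk (hS.measurable_Z k)

theorem Assumptions.identDistrib_XZ (hS : S.Assumptions) (k : ℕ) :
    IdentDistrib (fun ω => (S.X k ω, S.Z k ω)) (fun ω => (S.X 0 ω, S.Z 0 ω)) S.P S.P :=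
  (hS.identDistrib k).comp measurable_snd

/-- A square integrable envelope of the score, valid for all small parameter errors. -/
theorem Regularity.exists_envelope (hS : S.Assumptions) (hR : S.Regularity) :
    ∃ U ∈ 𝓝 ((S.beta0, 0) : EuclideanSpace ℝ (Fin q) × ℝ), ∃ g : 𝒳 × 𝒵 → ℝ,
      MemLp g 2 (S.P.map fun ω => (S.X 0 ω, S.Z 0 ω)) ∧
      ∀ᵐ s ∂(S.P.map fun ω => (S.X 0 ω, S.Z 0 ω)), ∀ t ∈ U,
        ‖(S.phi S.F + S.phiDot s.1 + t.2 - S.mu t.1 s.2) • S.A t.1 s.2‖ ≤ g s := by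
  obtain ⟨U₁, hU₁, g₁, hg₁, h₁⟩ := hR.dominated_A
  obtain ⟨U₂, hU₂, g₂, hg₂, h₂⟩ := hR.dominated_A_mu
  obtain ⟨M, hM0, hM⟩ := hS.exists_abs_phiDot_le
  have hmap : (S.P.map fun ω => (S.X 0 ω, S.Z 0 ω)).map Prod.snd = S.P.map (S.Z 0) := by
    rw [Measure.map_map measurable_snd (hS.measurable_XZ 0)]
    rfl
  have hmp : MeasurePreserving Prod.snd (S.P.map fun ω => (S.X 0 ω, S.Z 0 ω))
    (S.P.map (S.Z 0)) := ⟨measurable_snd, hmap⟩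
  set C := |S.phi S.F| + M + 1 with hC
  refine ⟨(U₁ ∩ U₂) ×ˢ Metric.ball 0 1,
    prod_mem_nhds (inter_mem hU₁ hU₂) (Metric.ball_mem_nhds _ one_pos),
    fun s => C * g₁ s.2 + g₂ s.2,
    ((hg₁.comp_measurePreserving hmp).const_mul C).add (hg₂.comp_measurePreserving hmp), ?_⟩
  rw [← hmap] at h₁ h₂
  filter_upwards [ae_of_ae_map measurable_snd.aemeasurable h₁,
    ae_of_ae_map measurable_snd.aemeasurable h₂] with s hs1 hs2 t ht
  have ht2 : |t.2| ≤ 1 := by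
    have := ht.2
    rw [Metric.mem_ball, dist_zero_right] at this
    exact this.le
  -- The product μA is split off whole: its envelope is g₂, while μ alone has none.
  rw [sub_smul]
  refine (norm_sub_le _ _).trans (add_le_add ?_ (hs2 _ ht.1.2))
  rw [norm_smul]
  refine mul_le_mul ?_ (hs1 _ ht.1.1) (norm_nonneg _) (by positivity)
  rw [Real.norm_eq_abs]
  exact (abs_add_le _ _).trans (add_le_add ((abs_add_le _ _).trans
    (add_le_add_right (hM _) _)) ht2)

theorem Regularity.memLp_firstOrderTerm (hS : S.Assumptions) (hR : S.Regularity) :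
    MemLp S.firstOrderTerm 2 S.P := by
  obtain ⟨U, hU, g, hg, h⟩ := hR.exists_envelope hS
  have hg' := (memLp_map_measure_iff hg.1 (hS.measurable_XZ 0).aemeasurable).1 hg
  refine hg'.mono' ?_ ?_
  · have h1 : Measurable fun ω => S.phi S.F + S.phiDot (S.X 0 ω) - S.mu S.beta0 (S.Z 0 ω) :=
      ((hS.measurable_phiDot.comp (hS.measurable_X 0)).const_add _).sub
        ((hS.measurable_mu _ hS.beta0_mem).comp (hS.measurable_Z 0))
    exact (h1.smul ((hS.measurable_A _ hS.beta0_mem).comp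
      (hS.measurable_Z 0))).aestronglyMeasurable
  · filter_upwards [ae_of_ae_map (hS.measurable_XZ 0).aemeasurable h] with ω hω
    simpa [firstOrderTerm] using hω _ (mem_of_mem_nhds hU)

theorem Regularity.memLp_A (hS : S.Assumptions) (hR : S.Regularity) (k : ℕ) :
    MemLp (fun ω => S.A S.beta0 (S.Z k ω)) 2 S.P := by
  obtain ⟨U, hU, g, hg, h⟩ := hR.dominated_A
  have hm := hS.measurable_A _ hS.beta0_mem
  have h0 : MemLp (S.A S.beta0) 2 (S.P.map (S.Z 0)) := by
    refine hg.mono' hm.aestronglyMeasurable ?_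
    filter_upwards [h] with z hz using hz _ (mem_of_mem_nhds hU)
  have hlaw : S.P.map (S.Z k) = S.P.map (S.Z 0) :=
    ((hS.identDistrib_XZ k).comp measurable_snd).map_eq
  rw [← hlaw] at h0
  exact (memLp_map_measure_iff hm.aestronglyMeasurable (hS.measurable_Z k).aemeasurable).1 h0

/-- φ̈ is bounded and A is square integrable; conditional expectation preserves L². -/
theorem Regularity.memLp_secondOrderTerm (hS : S.Assumptions) (hR : S.Regularity) :
    MemLp S.secondOrderTerm 2 S.P := by
  obtain ⟨M, hM0, hM⟩ := hS.exists_abs_phiDDot_le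
  refine MemLp.condExp (by norm_num) ?_
  refine (hR.memLp_A hS 1).of_le_mul (c := M) ?_ (Eventually.of_forall fun ω => ?_)
  · have h1 : Measurable fun ω => S.phiDDot (S.X 1 ω) (S.X 0 ω) :=
      hS.measurable_phiDDot.comp ((hS.measurable_X 1).prodMk (hS.measurable_X 0))
    exact (h1.smul ((hS.measurable_A _ hS.beta0_mem).comp
      (hS.measurable_Z 1))).aestronglyMeasurable
  · rw [norm_smul]
    exact mul_le_mul_of_nonneg_right (hM _ _) (norm_nonneg _)

/-- Given Z, the residual φ(F) + φ̇(X) - μ(β₀, Z) has mean zero by centring and correct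
specification, and A(β₀, Z) pulls out. Covariances of the first-order term are therefore plain
second moments. -/
theorem Assumptions.integral_firstOrderTerm_apply (hS : S.Assumptions) (hR : S.Regularity)
    (i : Fin q) : ∫ ω, S.firstOrderTerm ω i ∂S.P = 0 := by
  have := hS.prob
  have hm : MeasurableSpace.comap (S.Z 0) inferInstance ≤ (inferInstance : MeasurableSpace Ω) :=
    (hS.measurable_Z 0).comap_le
  obtain ⟨M, hM0, hM⟩ := hS.exists_abs_phiDot_le
  have hphi : Integrable (fun ω => S.phiDot (S.X 0 ω)) S.P :=
    Integrable.of_bound (hS.measurable_phiDot.comp (hS.measurable_X 0)).aestronglyMeasurable M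
      (Eventually.of_forall fun ω => hM _)
  have hmu : Integrable (fun ω => S.mu S.beta0 (S.Z 0 ω)) S.P :=
    integrable_condExp.congr hS.mean
  have hh : Integrable (fun ω => S.mu S.beta0 (S.Z 0 ω) - S.phi S.F) S.P :=
    hmu.sub (integrable_const _)
  have hhm : StronglyMeasurable[MeasurableSpace.comap (S.Z 0) inferInstance]
      (fun ω => S.mu S.beta0 (S.Z 0 ω) - S.phi S.F) :=
    (((hS.measurable_mu _ hS.beta0_mem).comp (comap_measurable (S.Z 0))).sub_const
      _).stronglyMeasurable
  have ham : StronglyMeasurable[MeasurableSpace.comap (S.Z 0) inferInstance]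
      (fun ω => S.A S.beta0 (S.Z 0 ω) i) :=
    ((hS.measurable_coord_A hS.beta0_mem i).comp (comap_measurable (S.Z 0))).stronglyMeasurable
  set R : Ω → ℝ := (fun ω => S.phiDot (S.X 0 ω)) -
    fun ω => S.mu S.beta0 (S.Z 0 ω) - S.phi S.F with hR'
  have hRz : S.P[R | MeasurableSpace.comap (S.Z 0) inferInstance] =ᵐ[S.P] 0 := by
    filter_upwards [condExp_sub hphi hh (MeasurableSpace.comap (S.Z 0) inferInstance),
      hS.centering, hS.mean] with ω h1 h2 h3
    rw [h1, Pi.sub_apply, h2, condExp_of_stronglyMeasurable hm hhm hh, h3]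
    simp
  have hprod : (fun ω => S.firstOrderTerm ω i) = (fun ω => S.A S.beta0 (S.Z 0 ω) i) * R := by
    funext ω
    simp only [firstOrderTerm, PiLp.smul_apply, smul_eq_mul, Pi.mul_apply, hR', Pi.sub_apply]
    ring
  have hint : Integrable ((fun ω => S.A S.beta0 (S.Z 0 ω) i) * R) S.P := by
    rw [← hprod]
    exact ((hR.memLp_firstOrderTerm hS).integrable (by norm_num)).eval_piLp i
  rw [hprod, ← integral_condExp hm, integral_congr_ae (g := fun _ => (0 : ℝ)), integral_zero]
  filter_upwards [condExp_mul_of_stronglyMeasurable_left ham hint (hphi.sub hh), hRz] with ω h1 h2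
  rw [h1, Pi.mul_apply, h2]
  simp

/-! ### Consistency for the first-order covariance -/

theorem Assumptions.tendsto_norm_sub_Fn (hS : S.Assumptions) {r : ℝ} (hr : 0 < r) :
    Tendsto (fun n => S.P {ω | r ≤ ‖S.F - S.Fn n ω‖}) atTop (𝓝 0) := by
  have h := (tendstoInMeasure_iff_norm.1 hS.rate) r hr
  refine tendsto_of_tendsto_of_tendsto_of_le_of_le' tendsto_const_nhds h
    (Eventually.of_forall fun _ => zero_le) ?_
  filter_upwards [eventually_ge_atTop 1] with n hn
  refine measure_mono fun ω (hω : r ≤ _) => ?_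
  have h1 : (1 : ℝ) ≤ (n : ℝ) ^ (1 / 4 : ℝ) :=
    Real.one_le_rpow (by exact_mod_cast hn) (by norm_num)
  change r ≤ ‖(n : ℝ) ^ (1 / 4 : ℝ) * ‖S.F - S.Fn n ω‖ - 0‖
  rw [sub_zero, norm_mul, norm_norm, Real.norm_of_nonneg (by linarith)]
  nlinarith [norm_nonneg (S.F - S.Fn n ω)]

/-- Consistency of the Huber-White estimator for the first-order covariance matrix. -/
theorem Assumptions.tendsto_huberWhite (hS : S.Assumptions) (hR : S.Regularity)
    {βhat : ℕ → Ω → EuclideanSpace ℝ (Fin q)} (hβ : S.Consistent βhat) :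
    MatrixTendstoInProb S.P (S.huberWhite βhat) S.SigmaTilde := by
  intro i j
  have := hS.prob
  obtain ⟨U, hU, g, hg, henv⟩ := hR.exists_envelope hS
  have hΘ : S.Theta ×ˢ (Set.univ : Set ℝ) ∈ 𝓝 ((S.beta0, 0) : EuclideanSpace ℝ (Fin q) × ℝ) :=
    prod_mem_nhds (hS.isOpen_Theta.mem_nhds hS.beta0_mem) univ_mem
  have hmeas : Measurable (S.scoreProduct i j (S.beta0, 0)) :=
    hS.measurable_scoreProduct i j hS.beta0_mem
  have hdom : ∀ᵐ s ∂(S.P.map fun ω => (S.X 0 ω, S.Z 0 ω)), ∀ t ∈ U,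
      |S.scoreProduct i j t s| ≤ g s ^ 2 := by
    filter_upwards [henv] with s hs t ht
    rw [scoreProduct, abs_mul, sq]
    have h1 := fun i => (PiLp.norm_apply_le
      ((S.phi S.F + S.phiDot s.1 + t.2 - S.mu t.1 s.2) • S.A t.1 s.2) i).trans (hs t ht)
    simp only [PiLp.smul_apply, smul_eq_mul, Real.norm_eq_abs] at h1
    exact mul_le_mul (h1 i) (h1 j) (abs_nonneg _) ((abs_nonneg _).trans (h1 i))
  -- The error bound holds for all k on the single event that F_n is near F, so no union bound over
  -- k is needed. Taking r / 2 makes the error strictly smaller than r.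
  have hτ : ∀ r > 0, Tendsto (fun n => S.P {ω | ∃ k < n, r ≤ dist
      (βhat n ω, S.pseudoObs n k ω - (S.phi S.F + S.phiDot (S.X k ω))) (S.beta0, (0 : ℝ))})
      atTop (𝓝 0) := by
    intro r hr
    obtain ⟨r₁, hr₁, N, hN⟩ := hS.pseudoObs_approx (half_pos hr)
    have h := ((tendstoInMeasure_iff_dist.1 hβ) r hr).add (hS.tendsto_norm_sub_Fn hr₁)
    rw [add_zero] at h
    refine tendsto_of_tendsto_of_tendsto_of_le_of_le' tendsto_const_nhds h
      (Eventually.of_forall fun _ => zero_le) ?_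
    filter_upwards [eventually_ge_atTop N] with n hn
    refine (measure_mono ?_).trans (measure_union_le _ _)
    rintro ω ⟨k, hk, hω⟩
    by_cases hF : r₁ ≤ ‖S.F - S.Fn n ω‖
    · exact Or.inr hF
    · left
      have h1 := hN n hn ω (not_le.1 hF) k hk
      rw [Prod.dist_eq, le_max_iff] at hω
      refine hω.resolve_right ?_
      rw [dist_zero_right, Real.norm_eq_abs]
      linarith
  have hdiff := tendstoInMeasure_average_sub hS.measurable_XZ
    (fun k => (hS.identDistrib_XZ k).map_eq) hΘ
    (fun t ht => hS.measurable_scoreProduct i j ht.1) (hR.continuousOn_scoreProduct i j) hU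
    hg.integrable_sq hdom hτ
  have hint : Integrable (fun ω => S.scoreProduct i j (S.beta0, 0) (S.X 0 ω, S.Z 0 ω)) S.P := by
    refine (integrable_map_measure hmeas.aestronglyMeasurable
      (hS.measurable_XZ 0).aemeasurable).1 ?_
    refine hg.integrable_sq.mono' hmeas.aestronglyMeasurable ?_
    filter_upwards [hdom] with s hs using hs _ (mem_of_mem_nhds hU)
  have hindep : Pairwise (Function.onFun (fun f g : Ω → ℝ => IndepFun f g S.P)
      fun k ω => S.scoreProduct i j (S.beta0, 0) (S.X k ω, S.Z k ω)) := fun k l hkl =>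
    (hS.indep.indepFun hkl).comp (hmeas.comp measurable_snd) (hmeas.comp measurable_snd)
  have hlln := strong_law_ae_real
    (fun k ω => S.scoreProduct i j (S.beta0, 0) (S.X k ω, S.Z k ω)) hint hindep
    (fun k => (hS.identDistrib_XZ k).comp hmeas)
  have hcov : S.SigmaTilde i j =
      ∫ ω, S.scoreProduct i j (S.beta0, 0) (S.X 0 ω, S.Z 0 ω) ∂S.P := by
    simp only [SigmaTilde, covMatrix, Matrix.of_apply, covariance,
      hS.integral_firstOrderTerm_apply hR, sub_zero]
    simp [firstOrderTerm, scoreProduct]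
  rw [← hcov] at hlln
  have havg : TendstoInMeasure S.P (fun (n : ℕ) ω => (n : ℝ)⁻¹ * ∑ k ∈ Finset.range n,
      S.scoreProduct i j (S.beta0, 0) (S.X k ω, S.Z k ω)) atTop
      (fun _ => S.SigmaTilde i j) := by
    refine tendstoInMeasure_of_tendsto_ae (fun n => ?_) ?_
    · exact ((Finset.measurable_fun_sum _ fun k _ =>
        hmeas.comp (hS.measurable_XZ k)).const_mul _).aestronglyMeasurable
    · filter_upwards [hlln] with ω hω
      simpa only [div_eq_inv_mul] using hω
  have hsum := TendstoInMeasure.add_real hdiff havg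
  simp only [sub_add_cancel, zero_add] at hsum
  simpa only [huberWhite_apply] using hsum

theorem MatrixTendstoInProb.unique {P : Measure Ω} [IsProbabilityMeasure P]
    {M : ℕ → Ω → Matrix (Fin q) (Fin q) ℝ} {L L' : Matrix (Fin q) (Fin q) ℝ}
    (h : MatrixTendstoInProb P M L) (h' : MatrixTendstoInProb P M L') : L = L' := by
  ext i j
  exact (tendstoInMeasure_ae_unique (h i j) (h' i j)).exists.choose_spec

end Consistency

end PseudoModel

/-! ### The counterexample -/

namespace PseudoModel

namespace SignModel

/-- A single observation: a group and two fair signs. -/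
abbrev Sample (q : ℕ) : Type := Fin q × Bool × Bool

variable {q : ℕ}

noncomputable section

/-- The real sign encoded by a Boolean. -/
def sgn (b : Bool) : ℝ := if b then 1 else -1

/-- The response: a covariate sign plus an independent noise sign. -/
def response (s : Sample q) : ℝ := sgn s.2.1 + sgn s.2.2

/-- The covariate: the group label, counted from `1`, with the covariate sign. -/
def covariate (s : Sample q) : ℝ := sgn s.2.1 * ((s.1 : ℕ) + 1)

/-- The regressor of group `j`. -/
def regressor (j : Fin q) (z : ℝ) : ℝ :=
  (if z = (j : ℕ) + 1 then 1 else 0) - if z = -((j : ℕ) + 1) then 1 else 0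

/-- Truncation to `[-2, 2]`. -/
def clip (x : ℝ) : ℝ := max (-2) (min x 2)

/-- Truncation serves only to bound δ on all of ℝ; the responses take the values -2, 0, 2. -/
theorem clip_response (s : Sample q) : clip (response s) = response s := by
  obtain ⟨j, b, e⟩ := s
  cases b <;> cases e <;> norm_num [clip, response, sgn]

theorem abs_clip_le (x : ℝ) : |clip x| ≤ 2 :=
  abs_le.2 ⟨le_max_left _ _, max_le (by norm_num) (min_le_right _ _)⟩

theorem measurable_clip : Measurable clip :=
  measurable_const.max (measurable_id.min measurable_const)

theorem measurable_regressor (j : Fin q) : Measurable (regressor j) :=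
  (Measurable.ite (measurableSet_singleton _) measurable_const measurable_const).sub
    (Measurable.ite (measurableSet_singleton _) measurable_const measurable_const)

theorem abs_regressor_le (j : Fin q) (z : ℝ) : |regressor j z| ≤ 1 := by
  unfold regressor
  split_ifs <;> norm_num

/-- Labels start at 1, so the values ±(j + 1) are distinct and the covariate determines both group
and sign. -/
theorem regressor_covariate (j : Fin q) (s : Sample q) :
    regressor j (covariate s) = if s.1 = j then sgn s.2.1 else 0 := by
  obtain ⟨i, b, e⟩ := s
  have h1 : ((i : ℕ) : ℝ) + 1 = (j : ℕ) + 1 ↔ i = j := by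
    rw [add_left_inj, Nat.cast_inj, Fin.ext_iff]
  have h2 : ((i : ℕ) : ℝ) + 1 ≠ -((j : ℕ) + 1) := by
    have : (0 : ℝ) ≤ (i : ℕ) := Nat.cast_nonneg _
    have : (0 : ℝ) ≤ (j : ℕ) := Nat.cast_nonneg _
    linarith
  have h3 : -(((i : ℕ) : ℝ) + 1) ≠ (j : ℕ) + 1 := fun h => h2 (by linarith)
  cases b
  · simp only [regressor, covariate, sgn, Bool.false_eq_true, if_false, neg_one_mul, neg_inj,
      h1, h3]
    split_ifs <;> simp_all
  · simp only [regressor, covariate, sgn, if_true, one_mul, h1, h2, if_false]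
    split_ifs <;> norm_num

/-- The law of an infinite sequence of independent, uniformly distributed observations. -/
def law (q : ℕ) [NeZero q] : Measure (ℕ → Sample q) :=
  Measure.infinitePi fun _ => (PMF.uniformOfFintype (Sample q)).toMeasure

instance [NeZero q] : IsProbabilityMeasure (law q) := by
  unfold law; infer_instance

/-- A linear model with one coefficient for every group, and pseudo-observations of the functional
`x ^ 2 + x` of the mean response. -/
def model (q : ℕ) [NeZero q] : PseudoModel (ℕ → Sample q) ℝ ℝ ℝ q where
  P := law q
  V k ω := response (ω k)
  X k ω := response (ω k)
  Z k ω := covariate (ω k)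
  delta := clip
  phi x := x ^ 2 + x
  F := 0
  Theta := Set.univ
  A _ z := WithLp.toLp 2 fun j => regressor j z
  mu β z := ∑ j, β j * regressor j z
  beta0 := WithLp.toLp 2 fun _ => 1

/-! ### Integrals and limit laws for the sign sequence -/

section Law

theorem measurable_coord {E : Type*} [MeasurableSpace E] (g : Sample q → E) (k : ℕ) :
    Measurable fun ω : ℕ → Sample q => g (ω k) :=
  Measurable.of_discrete.comp (measurable_pi_apply k)

variable [NeZero q]

theorem integrable_coord (g : Sample q → ℝ) (k : ℕ) :
    Integrable (fun ω => g (ω k)) (law q) :=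
  (measurePreserving_eval_infinitePi
    (fun _ => (PMF.uniformOfFintype (Sample q)).toMeasure) k).integrable_comp_of_integrable
      (Integrable.of_finite)

theorem memLp_coord (g : Sample q → ℝ) (k : ℕ) : MemLp (fun ω => g (ω k)) 2 (law q) := by
  refine (memLp_two_iff_integrable_sq (measurable_coord g k).aestronglyMeasurable).2 ?_
  exact integrable_coord (fun s => g s ^ 2) k

theorem integral_coord (g : Sample q → ℝ) (k : ℕ) :
    ∫ ω, g (ω k) ∂(law q) = (4 * q : ℝ)⁻¹ * ∑ j, ∑ b, ∑ e, g (j, b, e) := by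
  have h := (measurePreserving_eval_infinitePi
    (fun _ : ℕ => (PMF.uniformOfFintype (Sample q)).toMeasure) k).map_eq
  have h1 : ∫ ω, g (ω k) ∂(law q) = ∫ s, g s ∂(PMF.uniformOfFintype (Sample q)).toMeasure := by
    rw [← h, integral_map (measurable_pi_apply k).aemeasurable
      Measurable.of_discrete.aestronglyMeasurable]
    rfl
  rw [h1, PMF.integral_eq_sum]
  simp only [PMF.uniformOfFintype_apply, Fintype.card_prod, Fintype.card_fin, Fintype.card_bool,
    smul_eq_mul, ← Finset.mul_sum, Fintype.sum_prod_type]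
  congr 1
  simp
  ring

theorem iIndepFun_coord {E : Type*} [MeasurableSpace E] (g : Sample q → E) :
    iIndepFun (fun k ω => g (ω k)) (law q) :=
  iIndepFun_infinitePi (X := fun _ => g) fun _ => Measurable.of_discrete

theorem identDistrib_coord {E : Type*} [MeasurableSpace E] (g : Sample q → E) (k : ℕ) :
    IdentDistrib (fun ω => g (ω k)) (fun ω => g (ω 0)) (law q) (law q) := by
  have h : IdentDistrib (fun ω : ℕ → Sample q => ω k) (fun ω => ω 0) (law q) (law q) :=
    ⟨(measurable_pi_apply k).aemeasurable, (measurable_pi_apply 0).aemeasurable,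
      (measurePreserving_eval_infinitePi _ k).map_eq.trans
        (measurePreserving_eval_infinitePi
          (fun _ : ℕ => (PMF.uniformOfFintype (Sample q)).toMeasure) 0).map_eq.symm⟩
  exact h.comp (u := g) Measurable.of_discrete

theorem strong_law_coord (g : Sample q → ℝ) : ∀ᵐ ω ∂(law q),
    Tendsto (fun n : ℕ => (n : ℝ)⁻¹ * ∑ k ∈ Finset.range n, g (ω k)) atTop
      (𝓝 (∫ ω, g (ω 0) ∂(law q))) := by
  have h := strong_law_ae_real (fun k (ω : ℕ → Sample q) => g (ω k)) (integrable_coord g 0)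
    (fun i j hij => (iIndepFun_coord g).indepFun hij) (identDistrib_coord g)
  filter_upwards [h] with ω hω
  simpa only [div_eq_inv_mul] using hω

theorem integral_response (k : ℕ) : ∫ ω, response (ω k) ∂(law q) = 0 := by
  rw [integral_coord response]
  simp [response, sgn]

theorem integral_response_mul_regressor (j : Fin q) (k : ℕ) :
    ∫ ω, response (ω k) * regressor j (covariate (ω k)) ∂(law q) = (q : ℝ)⁻¹ := by
  rw [integral_coord fun s => response s * regressor j (covariate s)]
  simp only [regressor_covariate, response, sgn, Fintype.sum_bool]
  simp [Finset.sum_add_distrib]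
  have : (q : ℝ) ≠ 0 := Nat.cast_ne_zero.2 (NeZero.ne q)
  field_simp
  norm_num

theorem integral_regressor_sq (j : Fin q) (k : ℕ) :
    ∫ ω, regressor j (covariate (ω k)) ^ 2 ∂(law q) = (q : ℝ)⁻¹ := by
  rw [integral_coord fun s => regressor j (covariate s) ^ 2]
  simp only [regressor_covariate, sgn, Fintype.sum_bool]
  simp [Finset.sum_add_distrib, ite_pow]
  have : (q : ℝ) ≠ 0 := Nat.cast_ne_zero.2 (NeZero.ne q)
  field_simp
  norm_num

end Law

/-! ### Verification of the assumptions -/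

theorem hasFDerivAt_phi [NeZero q] (x : ℝ) : HasFDerivAt (model q).phi
    ((2 * x + 1) • ContinuousLinearMap.id ℝ ℝ) x := by
  have h : HasDerivAt (fun x : ℝ => x ^ 2 + x) (2 * x + 1) x := by
    simpa using! (hasDerivAt_pow 2 x).add (hasDerivAt_id x)
  have h2 : (2 * x + 1) • ContinuousLinearMap.id ℝ ℝ =
      ContinuousLinearMap.toSpanSingleton ℝ (2 * x + 1) := by
    ext
    simp
  rw [h2]
  exact h.hasFDerivAt

theorem fderiv_phi [NeZero q] : fderiv ℝ (model q).phi =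
    fun x => (2 * x + 1) • ContinuousLinearMap.id ℝ ℝ :=
  funext fun x => (hasFDerivAt_phi x).fderiv

theorem hasFDerivAt_fderiv_phi [NeZero q] (x : ℝ) : HasFDerivAt (fderiv ℝ (model q).phi)
    (((2 : ℝ) • ContinuousLinearMap.id ℝ ℝ).smulRight (ContinuousLinearMap.id ℝ ℝ)) x := by
  rw [fderiv_phi]
  have h : HasFDerivAt (fun x : ℝ => 2 * x + 1) ((2 : ℝ) • ContinuousLinearMap.id ℝ ℝ) x :=
    ((hasFDerivAt_id x).const_mul (2 : ℝ)).add_const 1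
  exact h.smul_const (ContinuousLinearMap.id ℝ ℝ)

theorem phiDot_eq [NeZero q] (x : ℝ) : (model q).phiDot x = clip x := by
  rw [phiDot, fderiv_phi]
  simp [model]

theorem phiDDot_eq [NeZero q] (x y : ℝ) : (model q).phiDDot x y = 2 * clip x * clip y := by
  rw [phiDDot, (hasFDerivAt_fderiv_phi _).fderiv]
  simp [model]

theorem mu_beta0 [NeZero q] (s : Sample q) :
    (model q).mu (model q).beta0 (covariate s) = sgn s.2.1 := by
  simp [model, regressor_covariate]

theorem measurable_A [NeZero q] (β : EuclideanSpace ℝ (Fin q)) : Measurable ((model q).A β) :=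
  (PiLp.continuous_toLp 2 _).measurable.comp (measurable_pi_lambda _ measurable_regressor)

theorem measurable_mu [NeZero q] (β : EuclideanSpace ℝ (Fin q)) : Measurable ((model q).mu β) :=
  Finset.measurable_fun_sum Finset.univ fun j _ => (measurable_regressor j).const_mul (β j)

/-- The noise sign averages out: the covariate does not see it. -/
theorem condExp_response [NeZero q] :
    (law q)[fun ω => response (ω 0) | MeasurableSpace.comap (fun ω => covariate (ω 0))
      inferInstance] =ᵐ[law q] fun ω => (model q).mu (model q).beta0 (covariate (ω 0)) := by
  have hz : Measurable fun ω : ℕ → Sample q => covariate (ω 0) := measurable_coord covariate 0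
  symm
  refine ae_eq_condExp_of_forall_setIntegral_eq hz.comap_le (integrable_coord _ 0)
    (fun s _ _ => (integrable_coord (fun s => (model q).mu (model q).beta0 (covariate s))
      0).integrableOn) ?_ ?_
  · rintro _ ⟨t, ht, rfl⟩ -
    have hset : ∀ g : Sample q → ℝ,
        ∫ ω in (fun ω : ℕ → Sample q => covariate (ω 0)) ⁻¹' t, g (ω 0) ∂(law q) =
        (4 * q : ℝ)⁻¹ * ∑ j, ∑ b, ∑ e, (covariate ⁻¹' t).indicator g (j, b, e) := fun g => by
      rw [← integral_coord _ 0, ← integral_indicator (hz ht)]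
      rfl
    rw [hset response, hset fun s => (model q).mu (model q).beta0 (covariate s)]
    congr 1
    refine Finset.sum_congr rfl fun j _ => Finset.sum_congr rfl fun b _ => ?_
    -- An event of σ(Z) contains both noise values or neither.
    have hmem : ((j, b, false) : Sample q) ∈ covariate ⁻¹' t ↔
        ((j, b, true) : Sample q) ∈ covariate ⁻¹' t := Iff.rfl
    simp only [Fintype.sum_bool]
    by_cases h : ((j, b, true) : Sample q) ∈ covariate ⁻¹' t
    · simp only [Set.indicator_of_mem h, Set.indicator_of_mem (hmem.2 h), mu_beta0, response, sgn,
        if_true, Bool.false_eq_true, if_false]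
      ring
    · simp only [Set.indicator_of_notMem h, Set.indicator_of_notMem (mt hmem.1 h)]
  · exact ((measurable_mu _).comp (comap_measurable _)).stronglyMeasurable.aestronglyMeasurable

theorem Fn_eq [NeZero q] (n : ℕ) (ω : ℕ → Sample q) :
    (model q).Fn n ω = (n : ℝ)⁻¹ * ∑ k ∈ Finset.range n, response (ω k) := by
  simp [Fn, model, clip_response]

/-- Chebyshev's inequality: n^{1/4} F_n has variance 2 n^{-1/2}. -/
theorem rate [NeZero q] : TendstoInMeasure (model q).P
    (fun (n : ℕ) ω => (n : ℝ) ^ (1 / 4 : ℝ) * ‖(model q).F - (model q).Fn n ω‖) atTop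
      (fun _ => 0) := by
  rw [tendstoInMeasure_iff_norm]
  intro ε hε
  have hvar : ∀ k, Var[fun ω => response (ω k); law q] = 2 := fun k => by
    rw [variance_of_integral_eq_zero (measurable_coord _ k).aemeasurable (integral_response k)]
    rw [integral_coord (fun s => response s ^ 2)]
    simp [response, sgn]
    have : (q : ℝ) ≠ 0 := Nat.cast_ne_zero.2 (NeZero.ne q)
    field_simp
    norm_num
  have hbound : ∀ n : ℕ, 1 ≤ n → (law q) {ω | ε ≤ ‖(n : ℝ) ^ (1 / 4 : ℝ) *
      ‖(model q).F - (model q).Fn n ω‖ - 0‖} ≤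
      ENNReal.ofReal (2 / ε ^ 2 * (n : ℝ) ^ (-(1 / 2) : ℝ)) := by
    intro n hn
    have hn0 : (0 : ℝ) < n := by exact_mod_cast hn
    set a : ℝ := (n : ℝ) ^ (1 / 4 : ℝ) * (n : ℝ)⁻¹ with ha
    set Y : (ℕ → Sample q) → ℝ := fun ω =>
      a * (∑ k ∈ Finset.range n, fun ω : ℕ → Sample q => response (ω k)) ω with hY
    have hYL : MemLp Y 2 (law q) :=
      (memLp_finsetSum' _ fun k _ => memLp_coord response k).const_mul a
    have hY0 : ∫ ω, Y ω ∂(law q) = 0 := by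
      simp only [hY, Finset.sum_apply]
      rw [integral_const_mul, integral_finsetSum _ fun k _ => integrable_coord response k]
      simp [integral_response]
    have hYv : Var[Y; law q] = 2 * (n : ℝ) ^ (-(1 / 2) : ℝ) := by
      rw [hY, variance_const_mul, IndepFun.variance_sum (fun k _ => memLp_coord response k)
        (fun i _ j _ hij => (iIndepFun_coord response).indepFun hij)]
      simp only [hvar, Finset.sum_const, Finset.card_range, nsmul_eq_mul]
      have h1 : a ^ 2 * n = (n : ℝ) ^ (-(1 / 2) : ℝ) := by
        rw [ha, ← Real.rpow_neg_one (n : ℝ), ← Real.rpow_add hn0, ← Real.rpow_natCast,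
          ← Real.rpow_mul hn0.le]
        nth_rewrite 2 [← Real.rpow_one (n : ℝ)]
        rw [← Real.rpow_add hn0]
        norm_num
      rw [← mul_assoc, h1, mul_comm]
    have hcheb := meas_ge_le_variance_div_sq hYL hε
    rw [hY0, hYv] at hcheb
    refine le_trans (measure_mono fun ω hω => ?_) (hcheb.trans_eq ?_)
    · change ε ≤ _ at hω
      change ε ≤ _
      refine hω.trans_eq ?_
      rw [Fn_eq, sub_zero, sub_zero]
      simp only [hY, ha, model, Finset.sum_apply, zero_sub, norm_neg]
      simp only [← Real.norm_eq_abs, norm_mul, norm_norm, mul_assoc]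
    · congr 1
      ring
  have hlim : Tendsto (fun n : ℕ => ENNReal.ofReal (2 / ε ^ 2 * (n : ℝ) ^ (-(1 / 2) : ℝ))) atTop
      (𝓝 0) := by
    rw [← ENNReal.ofReal_zero]
    refine ENNReal.tendsto_ofReal ?_
    simpa using ((tendsto_rpow_neg_atTop (by norm_num : (0 : ℝ) < 1 / 2)).comp
      tendsto_natCast_atTop_atTop).const_mul (2 / ε ^ 2)
  refine tendsto_of_tendsto_of_tendsto_of_le_of_le' tendsto_const_nhds hlim
    (Eventually.of_forall fun _ => zero_le) ?_
  filter_upwards [eventually_ge_atTop 1] with n hn using hbound n hn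

theorem assumptions [NeZero q] : (model q).Assumptions where
  prob := inferInstanceAs (IsProbabilityMeasure (law q))
  measurable_V := measurable_coord response
  measurable_X := measurable_coord response
  measurable_Z := measurable_coord covariate
  indep := iIndepFun_coord fun s => (response s, response s, covariate s)
  identDistrib := identDistrib_coord fun s => (response s, response s, covariate s)
  integrable_V := integrable_coord response 0
  isOpen_Theta := isOpen_univ
  beta0_mem := Set.mem_univ _
  measurable_A β _ := measurable_A β
  measurable_mu β _ := measurable_mu β
  measurable_phiDot := by
    rw [funext phiDot_eq]
    exact measurable_clip
  measurable_phiDDot := by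
    simp only [phiDDot_eq]
    exact ((measurable_clip.comp measurable_fst).const_mul 2).mul
      (measurable_clip.comp measurable_snd)
  mean := condExp_response
  rate := rate
  bounded_delta := ⟨2, by norm_num, abs_clip_le⟩
  smooth := ⟨Set.univ, univ_mem, fun x _ => (hasFDerivAt_phi x).differentiableAt,
    fun x _ => (hasFDerivAt_fderiv_phi x).differentiableAt, 0, by
      rw [funext fun x => (hasFDerivAt_fderiv_phi (q := q) x).fderiv]
      exact (LipschitzWith.const _).lipschitzOnWith⟩
  centering := by
    have h1 : (fun ω => (model q).phiDot ((model q).X 0 ω)) = (model q).V 0 := by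
      funext ω
      rw [phiDot_eq]
      exact clip_response _
    have h2 : (model q).phi (model q).F = 0 := by simp [model]
    simp only [h1, h2, sub_zero]
    exact EventuallyEq.rfl

theorem norm_A_le [NeZero q] (β : EuclideanSpace ℝ (Fin q)) (z : ℝ) : ‖(model q).A β z‖ ≤ √q := by
  rw [EuclideanSpace.norm_eq]
  refine Real.sqrt_le_sqrt ?_
  calc ∑ j, ‖(model q).A β z j‖ ^ 2 ≤ ∑ _j : Fin q, (1 : ℝ) :=
        Finset.sum_le_sum fun j _ => pow_le_one₀ (norm_nonneg _) (abs_regressor_le j z)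
    _ = q := by simp

theorem abs_mu_le [NeZero q] (β : EuclideanSpace ℝ (Fin q)) (z : ℝ) :
    |(model q).mu β z| ≤ q * ‖β‖ := by
  calc |(model q).mu β z| ≤ ∑ j, |β j * regressor j z| := Finset.abs_sum_le_sum_abs (fun j => β j * regressor j z) Finset.univ
    _ ≤ ∑ _j : Fin q, ‖β‖ := Finset.sum_le_sum fun j _ => by
        rw [abs_mul]
        exact (mul_le_of_le_one_right (abs_nonneg _) (abs_regressor_le j z)).trans
          (PiLp.norm_apply_le β j)
    _ = q * ‖β‖ := by simp

theorem regularity [NeZero q] : (model q).Regularity := by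
  have hprob : IsProbabilityMeasure ((model q).P.map ((model q).Z 0)) :=
    have := (assumptions (q := q)).prob
    Measure.isProbabilityMeasure_map ((assumptions (q := q)).measurable_Z 0).aemeasurable
  refine ⟨fun z => continuousOn_const, fun z => ?_, ?_, ?_⟩
  · have h : Continuous fun β : EuclideanSpace ℝ (Fin q) => ∑ j, β j * regressor j z :=
      continuous_finsetSum _ fun j _ =>
        (EuclideanSpace.proj j : EuclideanSpace ℝ (Fin q) →L[ℝ] ℝ).continuous.mul_const _
    exact h.continuousOn
  · exact ⟨Set.univ, univ_mem, fun _ => √q, memLp_const _,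
      Eventually.of_forall fun z β _ => norm_A_le β z⟩
  · refine ⟨Metric.ball (model q).beta0 1, Metric.ball_mem_nhds _ one_pos,
      fun _ => q * (‖(model q).beta0‖ + 1) * √q, memLp_const _,
      Eventually.of_forall fun z β hβ => ?_⟩
    rw [norm_smul]
    refine mul_le_mul ((abs_mu_le β z).trans ?_) (norm_A_le β z) (norm_nonneg _) (by positivity)
    have h1 : ‖β - (model q).beta0‖ < 1 := mem_ball_iff_norm.1 hβ
    have h2 := norm_le_norm_add_norm_sub' β (model q).beta0
    gcongr
    linarith

/-! ### A consistent root of the estimating equation -/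

/-- The least squares estimator for the pseudo-observations. -/
def estimator (q : ℕ) [NeZero q] (n : ℕ) (ω : ℕ → Sample q) : EuclideanSpace ℝ (Fin q) :=
  WithLp.toLp 2 fun j =>
    (∑ k ∈ Finset.range n, (model q).pseudoObs n k ω * regressor j (covariate (ω k))) /
      ∑ k ∈ Finset.range n, regressor j (covariate (ω k)) ^ 2

theorem measurable_pseudoObs [NeZero q] (n k : ℕ) : Measurable ((model q).pseudoObs n k) := by
  have hphi : Measurable (model q).phi := (measurable_id.pow_const 2).add measurable_id
  have hd : ∀ k, Measurable fun ω => (model q).delta ((model q).X k ω) := fun k =>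
    measurable_clip.comp (measurable_coord response k)
  have h1 : Measurable ((model q).Fn n) :=
    (Finset.measurable_fun_sum _ fun k _ => hd k).const_smul (n : ℝ)⁻¹
  have h2 : Measurable ((model q).FnLoo n k) :=
    (Finset.measurable_fun_sum _ fun k _ => hd k).const_smul ((n : ℝ) - 1)⁻¹
  exact ((hphi.comp h1).const_mul _).sub ((hphi.comp h2).const_mul _)

theorem measurable_estimator [NeZero q] (n : ℕ) : Measurable (estimator q n) := by
  refine (PiLp.continuous_toLp 2 _).measurable.comp (measurable_pi_lambda _ fun j => ?_)
  have hr : ∀ k, Measurable fun ω : ℕ → Sample q => regressor j (covariate (ω k)) := fun k =>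
    measurable_coord (fun s => regressor j (covariate s)) k
  exact (Finset.measurable_fun_sum _ fun k _ => (measurable_pseudoObs n k).mul (hr k)).div
    (Finset.measurable_fun_sum _ fun k _ => (hr k).pow_const 2)

/-- The regressors have disjoint supports, so the estimating equation decouples into one scalar
equation per group. -/
theorem mu_mul_regressor [NeZero q] (β : EuclideanSpace ℝ (Fin q)) (j : Fin q) (s : Sample q) :
    (model q).mu β (covariate s) * regressor j (covariate s) =
      β j * regressor j (covariate s) ^ 2 := by
  have h : (model q).mu β (covariate s) = β s.1 * sgn s.2.1 := by
    simp [model, regressor_covariate]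
  rw [h, regressor_covariate]
  split_ifs with hj
  · rw [hj]
    ring
  · simp

theorem solvesEstimatingEq_estimator [NeZero q] :
    (model q).SolvesEstimatingEq (estimator q) := by
  intro n ω
  ext j
  have h1 : (∑ k ∈ Finset.range n, ((model q).pseudoObs n k ω -
      (model q).mu (estimator q n ω) ((model q).Z k ω)) •
        (model q).A (estimator q n ω) ((model q).Z k ω)) j =
      ∑ k ∈ Finset.range n, (model q).pseudoObs n k ω * regressor j (covariate (ω k)) -
        estimator q n ω j * ∑ k ∈ Finset.range n, regressor j (covariate (ω k)) ^ 2 := by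
    rw [WithLp.ofLp_sum, Finset.sum_apply, Finset.mul_sum, ← Finset.sum_sub_distrib]
    refine Finset.sum_congr rfl fun k _ => ?_
    rw [← mu_mul_regressor, ← sub_mul]
    rfl
  rw [h1]
  change _ - _ / _ * _ = (0 : ℝ)
  -- With no observation from group j, all its regressors vanish and the equation holds whatever
  -- value the division by zero takes.
  by_cases h0 : ∑ k ∈ Finset.range n, regressor j (covariate (ω k)) ^ 2 = 0
  · have h2 := (Finset.sum_eq_zero_iff_of_nonneg fun k _ => sq_nonneg _).1 h0
    rw [h0, mul_zero, sub_zero]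
    refine Finset.sum_eq_zero fun k hk => ?_
    rw [pow_eq_zero_iff two_ne_zero |>.1 (h2 k hk), mul_zero]
  · rw [div_mul_cancel₀ _ h0, sub_self]

/-- `Assumptions.pseudoObs_approx` is pathwise, so where F_n → F the pseudo-observations may be
replaced by the responses. The strong law then gives the ratio (1/q)/(1/q) = 1. -/
theorem consistent_estimator [NeZero q] : (model q).Consistent (estimator q) := by
  have := (assumptions (q := q)).prob
  refine tendstoInMeasure_of_tendsto_ae
    (fun n => (measurable_estimator n).aestronglyMeasurable) ?_
  have hq : (q : ℝ)⁻¹ ≠ 0 := inv_ne_zero (Nat.cast_ne_zero.2 (NeZero.ne q))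
  have hall : ∀ᵐ ω ∂(law q), ∀ j : Fin q,
      Tendsto (fun n : ℕ => (n : ℝ)⁻¹ * ∑ k ∈ Finset.range n,
        response (ω k) * regressor j (covariate (ω k))) atTop (𝓝 (q : ℝ)⁻¹) ∧
      Tendsto (fun n : ℕ => (n : ℝ)⁻¹ * ∑ k ∈ Finset.range n,
        regressor j (covariate (ω k)) ^ 2) atTop (𝓝 (q : ℝ)⁻¹) := by
    rw [ae_all_iff]
    intro j
    have h1 := strong_law_coord (q := q) fun s => response s * regressor j (covariate s)
    have h2 := strong_law_coord (q := q) fun s => regressor j (covariate s) ^ 2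
    rw [integral_response_mul_regressor] at h1
    rw [integral_regressor_sq] at h2
    filter_upwards [h1, h2] with ω hω1 hω2 using ⟨hω1, hω2⟩
  have hF := strong_law_coord (q := q) response
  rw [integral_response] at hF
  filter_upwards [hall, hF] with ω hω hFω
  have hlim : Tendsto (fun n j => estimator q n ω j) atTop (𝓝 fun _ => 1) := by
    rw [tendsto_pi_nhds]
    intro j
    have hnum : Tendsto (fun n : ℕ => (n : ℝ)⁻¹ * ∑ k ∈ Finset.range n,
        (model q).pseudoObs n k ω * regressor j (covariate (ω k))) atTop (𝓝 (q : ℝ)⁻¹) := by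
      have hd : Tendsto (fun n : ℕ => (n : ℝ)⁻¹ * ∑ k ∈ Finset.range n,
          ((model q).pseudoObs n k ω - response (ω k)) * regressor j (covariate (ω k))) atTop
          (𝓝 0) := by
        rw [Metric.tendsto_atTop]
        intro ε hε
        obtain ⟨r, hr, N, hN⟩ := (assumptions (q := q)).pseudoObs_approx (half_pos hε)
        obtain ⟨N', hN'⟩ := Metric.tendsto_atTop.1 hFω r hr
        refine ⟨max N N', fun n hn => ?_⟩
        have hFn : ‖(model q).F - (model q).Fn n ω‖ < r := by
          have h := hN' n (le_trans (le_max_right _ _) hn)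
          rw [← Fn_eq, dist_zero_right] at h
          rw [norm_sub_rev]
          simpa [model] using h
        have hk := hN n (le_trans (le_max_left _ _) hn) ω hFn
        rw [dist_zero_right, norm_mul]
        have hterm : ∀ k ∈ Finset.range n, ‖((model q).pseudoObs n k ω - response (ω k)) *
            regressor j (covariate (ω k))‖ ≤ ε / 2 := fun k hkn => by
          have h := hk k (Finset.mem_range.1 hkn)
          have h0 : (model q).phi (model q).F + (model q).phiDot ((model q).X k ω) =
              response (ω k) := by
            rw [phiDot_eq]
            change (0 : ℝ) ^ 2 + 0 + clip (response (ω k)) = _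
            rw [clip_response]
            ring
          rw [h0] at h
          rw [norm_mul]
          exact (mul_le_of_le_one_right (norm_nonneg _) (abs_regressor_le _ _)).trans h
        have hsum := norm_sum_le_of_le _ hterm
        rw [Finset.sum_const, Finset.card_range, nsmul_eq_mul] at hsum
        calc _ ≤ ‖(n : ℝ)⁻¹‖ * (n * (ε / 2)) := by gcongr
          _ = ((n : ℝ)⁻¹ * n) * (ε / 2) := by
              rw [Real.norm_of_nonneg (by positivity), mul_assoc]
          _ ≤ 1 * (ε / 2) := by gcongr; exact inv_mul_le_one
          _ < ε := by linarith
      have h := hd.add (hω j).1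
      rw [zero_add] at h
      refine h.congr fun n => ?_
      rw [← mul_add, ← Finset.sum_add_distrib]
      congr 1
      exact Finset.sum_congr rfl fun k _ => by ring
    have hdiv := hnum.div (hω j).2 hq
    rw [div_self hq] at hdiv
    refine hdiv.congr' ?_
    filter_upwards [eventually_ge_atTop 1] with n hn
    exact mul_div_mul_left _ _ (inv_ne_zero (by exact_mod_cast (by omega : n ≠ 0)))
  exact ((PiLp.continuous_toLp 2 _).tendsto _).comp hlim

/-! ### The two covariance matrices differ -/

/-- On responses φ̈(X₂, X₁) = 2X₂X₁. The factor X₁ pulls out, and what remains is independent of X₁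
with mean 2/q. -/
theorem secondOrderTerm_apply [NeZero q] (j : Fin q) :
    (fun ω => (model q).secondOrderTerm ω j) =ᵐ[law q]
      fun ω => response (ω 0) * (2 * (q : ℝ)⁻¹) := by
  have hx : Measurable fun ω : ℕ → Sample q => response (ω 0) := measurable_coord response 0
  let g : Sample q → ℝ := fun s => 2 * (response s * regressor j (covariate s))
  have hg : Measurable g := Measurable.of_discrete
  have hindep : IndepFun (fun ω : ℕ → Sample q => response (ω 0)) (fun ω => g (ω 1)) (law q) :=
    ((iIndepFun_coord (q := q) id).indepFun zero_ne_one).comp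
      (φ := response) Measurable.of_discrete hg
  have hprod : Integrable ((fun ω : ℕ → Sample q => response (ω 0)) * fun ω => g (ω 1)) (law q) :=
    hindep.integrable_mul (integrable_coord response 0) (integrable_coord g 1)
  have hpull := condExp_mul_of_stronglyMeasurable_left
    (m := MeasurableSpace.comap (fun ω : ℕ → Sample q => response (ω 0)) inferInstance)
    (comap_measurable _).stronglyMeasurable hprod (integrable_coord g 1)
  have hconst := condExp_indep_eq (μ := law q) (measurable_coord g 1).comap_le hx.comap_le
    (comap_measurable _).stronglyMeasurable hindep.symm
  have hint : Integrable (fun ω => (model q).phiDDot ((model q).X 1 ω) ((model q).X 0 ω) •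
      (model q).A (model q).beta0 ((model q).Z 1 ω)) (law q) := by
    refine Integrable.of_bound (C := 8 * √q) ?_ (Eventually.of_forall fun ω => ?_)
    · have h := assumptions (q := q)
      exact ((h.measurable_phiDDot.comp ((h.measurable_X 1).prodMk (h.measurable_X 0))).smul
        ((measurable_A _).comp (h.measurable_Z 1))).aestronglyMeasurable
    · rw [norm_smul, phiDDot_eq, norm_mul, norm_mul]
      have h2 : ‖(2 : ℝ)‖ = 2 := by norm_num
      rw [h2, show (8 : ℝ) = 2 * 2 * 2 by norm_num]
      gcongr
      exacts [abs_clip_le _, abs_clip_le _, norm_A_le _ _]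
  have hcomm := (EuclideanSpace.proj j : EuclideanSpace ℝ (Fin q) →L[ℝ] ℝ).comp_condExp_comm
    (m := MeasurableSpace.comap (fun ω : ℕ → Sample q => response (ω 0)) inferInstance) hint
  have hfun : (EuclideanSpace.proj j : EuclideanSpace ℝ (Fin q) →L[ℝ] ℝ) ∘
      (fun ω => (model q).phiDDot ((model q).X 1 ω) ((model q).X 0 ω) •
        (model q).A (model q).beta0 ((model q).Z 1 ω)) =
      (fun ω : ℕ → Sample q => response (ω 0)) * fun ω => g (ω 1) := by
    funext ω
    simp only [Function.comp_apply, phiDDot_eq, map_smul, smul_eq_mul, Pi.mul_apply]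
    change 2 * clip (response (ω 1)) * clip (response (ω 0)) * regressor j (covariate (ω 1)) =
      response (ω 0) * (2 * (response (ω 1) * regressor j (covariate (ω 1))))
    rw [clip_response, clip_response]
    ring
  rw [hfun] at hcomm
  have hgint : ∫ ω, g (ω 1) ∂(law q) = 2 * (q : ℝ)⁻¹ := by
    simp only [g]
    rw [integral_const_mul, integral_response_mul_regressor]
  filter_upwards [hcomm, hpull, hconst] with ω h1 h2 h3
  rw [← hgint, ← h3]
  exact h1.trans h2

theorem Sigma_ne_SigmaTilde [NeZero q] : (model q).Sigma ≠ (model q).SigmaTilde := by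
  intro heq
  have hq : (q : ℝ) ≠ 0 := Nat.cast_ne_zero.2 (NeZero.ne q)
  let j : Fin q := 0
  let u : Sample q → ℝ := fun s => (response s - sgn s.2.1) * regressor j (covariate s)
  let v : Sample q → ℝ := fun s => u s + response s * (2 * (q : ℝ)⁻¹)
  have hu : (fun ω => (model q).firstOrderTerm ω j) = fun ω => u (ω 0) := by
    funext ω
    have h1 : (model q).firstOrderTerm ω j = ((model q).phi (model q).F +
        (model q).phiDot (response (ω 0)) - (model q).mu (model q).beta0 (covariate (ω 0))) *
          regressor j (covariate (ω 0)) := rfl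
    have h2 : (model q).phi (model q).F = 0 := by simp [model]
    rw [h1, h2, phiDot_eq, clip_response, mu_beta0, zero_add]
  have hv : (fun ω => ((model q).firstOrderTerm ω + (model q).secondOrderTerm ω) j) =ᵐ[law q]
      fun ω => v (ω 0) := by
    filter_upwards [secondOrderTerm_apply (q := q) j] with ω hω
    rw [PiLp.add_apply, hω, congrFun hu ω]
  have hcov : ∀ w : Sample q → ℝ, ∫ ω, w (ω 0) ∂(law q) = 0 →
      cov[fun ω => w (ω 0), fun ω => w (ω 0); law q] =
        (4 * q : ℝ)⁻¹ * ∑ i, ∑ b, ∑ e, w (i, b, e) * w (i, b, e) := fun w hw => by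
    rw [covariance, hw]
    simp only [sub_zero]
    exact integral_coord (fun s => w s * w s) 0
  have hTilde : (model q).SigmaTilde j j = (q : ℝ)⁻¹ := by
    change cov[fun ω => (model q).firstOrderTerm ω j, fun ω => (model q).firstOrderTerm ω j;
      law q] = _
    rw [hu, hcov u]
    · simp only [u, regressor_covariate, response, sgn, Fintype.sum_bool]
      simp [Finset.sum_add_distrib]
      field_simp
      norm_num
    · rw [integral_coord u]
      simp [u, regressor_covariate, response, sgn]
  have hSigma : (model q).Sigma j j = (q : ℝ)⁻¹ + 8 * ((q : ℝ)⁻¹) ^ 2 := by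
    change cov[fun ω => ((model q).firstOrderTerm ω + (model q).secondOrderTerm ω) j,
      fun ω => ((model q).firstOrderTerm ω + (model q).secondOrderTerm ω) j; law q] = _
    rw [covariance, integral_congr_ae hv, integral_congr_ae
      (hv.mono fun ω h => congrArg (fun x => (x - _) * (x - _)) h), ← covariance, hcov v]
    -- Over the four sign pairs, u² sums to 4 on group j, X² sums to 8 (whence 32/q²), and the cross
    -- terms cancel.
    · have hsum : ∀ i, ∑ b, ∑ e, v (i, b, e) * v (i, b, e) =
          (if i = j then 4 else 0) + 32 * ((q : ℝ)⁻¹) ^ 2 := fun i => by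
        simp only [v, u, regressor_covariate, response, sgn, Fintype.sum_bool]
        by_cases hij : i = j <;>
          simp only [hij, if_true, if_false, Bool.false_eq_true] <;> ring
      simp only [hsum, Finset.sum_add_distrib]
      simp
      field_simp
      ring
    · rw [integral_coord v]
      have hsum : ∀ i, ∑ b, ∑ e, v (i, b, e) = 0 := fun i => by
        simp only [v, u, regressor_covariate, response, sgn, Fintype.sum_bool]
        by_cases hij : i = j <;>
          simp only [hij, if_true, if_false, Bool.false_eq_true] <;> ring
      simp only [hsum, Finset.sum_const_zero, mul_zero]
  rw [heq, hTilde] at hSigma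
  have : 0 < ((q : ℝ)⁻¹) ^ 2 := by positivity
  linarith

end

end SignModel

end PseudoModel

/-! ### Conclusion -/

theorem theorem1 :
    (∀ (Ω 𝒳 𝒵 D : Type*) [MeasurableSpace Ω] [MeasurableSpace 𝒳] [MeasurableSpace 𝒵]
        [NormedAddCommGroup D] [NormedSpace ℝ D] [CompleteSpace D] (q : ℕ)
        (S : PseudoModel Ω 𝒳 𝒵 D q) (βhat : ℕ → Ω → EuclideanSpace ℝ (Fin q)),
        S.Assumptions → S.Regularity → S.Consistent βhat →
          MemLp S.firstOrderTerm 2 S.P ∧ MemLp S.secondOrderTerm 2 S.P ∧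
          PseudoModel.MatrixTendstoInProb S.P (S.huberWhite βhat) S.SigmaTilde ∧
          (PseudoModel.MatrixTendstoInProb S.P (S.huberWhite βhat) S.Sigma ↔
            S.Sigma = S.SigmaTilde)) ∧
    (∀ q : ℕ, 0 < q →
      ∃ (Ω : Type) (_ : MeasurableSpace Ω) (S : PseudoModel Ω ℝ ℝ ℝ q),
        S.Assumptions ∧ S.Regularity ∧
        (∃ βhat : ℕ → Ω → EuclideanSpace ℝ (Fin q),
          (∀ n, Measurable (βhat n)) ∧ S.SolvesEstimatingEq βhat ∧ S.Consistent βhat) ∧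
        ∀ βhat : ℕ → Ω → EuclideanSpace ℝ (Fin q), S.Consistent βhat →
          ¬ PseudoModel.MatrixTendstoInProb S.P (S.huberWhite βhat) S.Sigma) := by
  refine ⟨?_, fun q hq => ?_⟩
  · intro Ω 𝒳 𝒵 D _ _ _ _ _ _ q S βhat hS hR hβ
    have := hS.prob
    have hlim := hS.tendsto_huberWhite hR hβ
    refine ⟨hR.memLp_firstOrderTerm hS, hR.memLp_secondOrderTerm hS, hlim,
      fun h => h.unique hlim, fun h => ?_⟩
    rw [h]
    exact hlim
  · have : NeZero q := ⟨hq.ne'⟩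
    refine ⟨_, _, PseudoModel.SignModel.model q, PseudoModel.SignModel.assumptions,
      PseudoModel.SignModel.regularity, ⟨PseudoModel.SignModel.estimator q,
        PseudoModel.SignModel.measurable_estimator,
        PseudoModel.SignModel.solvesEstimatingEq_estimator,
        PseudoModel.SignModel.consistent_estimator⟩, fun βhat hβ h => ?_⟩
    have hS := PseudoModel.SignModel.assumptions (q := q)
    have := hS.prob
    exact PseudoModel.SignModel.Sigma_ne_SigmaTilde
      (h.unique (hS.tendsto_huberWhite PseudoModel.SignModel.regularity hβ))
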